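/- Let $\alpha\in(\tfrac32,2]$ and let $X^1,X^2$ be independent real-valued symmetric $\alpha$-stable processes on a probability space, i.e. each $X^j$ is a Lévy process (with a.s. càdlàg paths) such that $X^j_1$ is symmetric, not a.s. zero, and strictly stable of index $\alpha$: for all $A,B>0$ and independent copies $Z_1,Z_2$ of $X^j_1$, $AZ_1+BZ_2\overset{d}{=}(A^\alpha+B^\alpha)^{1/\alpha}X^j_1$. For $\varepsilon>0$ put $$\theta_\varepsilon=\frac{i}{2\pi}\int_0^1\int_0^1\int_{\mathbb R}p\,e^{ip(X^1_t-X^2_s)}e^{-\varepsilon p^2/2}\,dp\,ds\,dt .$$ Then, as $\varepsilon\downarrow0$, $\theta_\varepsilon$ converges almost surely and in $L^q$ for every $q\in(0,\infty)$ to a real random variable $\theta$, the derivative of the intersection local time of $X^1$ and $X^2$ on $[0,1]^2$ (formally $\theta=\frac{i}{2\pi}\int_0^1\int_0^1\int_{\mathbb R}p\,e^{ip(X^1_t-X^2_s)}\,dp\,ds\,dt$). Moreover, for every $\beta\in[0,\frac{\alpha}{3})$ there is a constant $M>0$ such that $\mathbb E[\exp(M|\theta|^\beta)]<\infty$. -/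

import Mathlib

open MeasureTheory ProbabilityTheory Filter Topology
open scoped ENNReal NNReal

/-- A real-valued Lévy process `X = (X_t)_{t ≥ 0}`: random variables `X_t` with `X_0 = 0` almost
surely, independent and stationary increments, and almost surely càdlàg paths (right-continuous
with left limits; at `t = 0` the left-limit clause is void). Stochastic continuity follows from
the path regularity. -/
structure IsLevyProcess {Ω : Type*} [MeasurableSpace Ω] (P : Measure Ω)
    (X : ℝ≥0 → Ω → ℝ) : Prop where
  measurable : ∀ t, Measurable (X t)
  zero : ∀ᵐ ω ∂P, X 0 ω = 0
  indep_increments : HasIndepIncrements X P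
  stationary_increments : ∀ s t : ℝ≥0,
    IdentDistrib (fun ω => X (s + t) ω - X s ω) (X t) P P
  cadlag : ∀ᵐ ω ∂P, ∀ t : ℝ≥0,
    ContinuousWithinAt (fun s => X s ω) (Set.Ici t) t ∧
      ∃ l : ℝ, Tendsto (fun s => X s ω) (𝓝[<] t) (𝓝 l)

/-- A law `ν` on `ℝ` is strictly stable with index `α` if for all `A, B > 0`, and for independent
copies `Z₁, Z₂` of a random variable `Z` with law `ν` (that is, `(Z₁, Z₂)` has law `ν ⊗ ν`),
`A Z₁ + B Z₂` has the same law as `(A ^ α + B ^ α) ^ (1 / α) Z`. -/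
def IsStrictlyStableLaw (α : ℝ) (ν : Measure ℝ) : Prop :=
  ∀ A B : ℝ, 0 < A → 0 < B →
    (ν.prod ν).map (fun z : ℝ × ℝ => A * z.1 + B * z.2) =
      ν.map (fun z : ℝ => (A ^ α + B ^ α) ^ (1 / α) * z)

/-- A symmetric `α`-stable process: a Lévy process `X` for which `X_1` is strictly stable with
index `α`, symmetric (`-X_1` and `X_1` have the same law), and not almost surely `0`. The last
clause is what makes the scale parameter `σ` in `E exp(iuX_t) = exp(-t σ^α |u|^α)` positive. -/
structure IsSymmetricStableProcess {Ω : Type*} [MeasurableSpace Ω] (α : ℝ) (P : Measure Ω)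
    (X : ℝ≥0 → Ω → ℝ) : Prop where
  levy : IsLevyProcess P X
  stable : IsStrictlyStableLaw α (P.map (X 1))
  symmetric : IdentDistrib (fun ω => -X 1 ω) (X 1) P P
  nondegenerate : ¬ ∀ᵐ ω ∂P, X 1 ω = 0

/-- The regularised derivative of the intersection local time on `[0,1]²`,
`θ_ε = ∫₀¹ ∫₀¹ ρ_ε'(X_t - Y_s) ds dt` for the Gaussian kernel `ρ_ε` of variance `ε > 0`, in its
Fourier form
`θ_ε = (i / 2π) ∫₀¹ ∫₀¹ ∫_ℝ p exp(i p (X_t - Y_s)) exp(-ε p² / 2) dp ds dt`. -/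
noncomputable def diltApprox {Ω : Type*} (X Y : ℝ≥0 → Ω → ℝ) (ε : ℝ) (ω : Ω) : ℂ :=
  Complex.I / (2 * (Real.pi : ℂ)) *
    ∫ t in (0 : ℝ)..1, ∫ s in (0 : ℝ)..1, ∫ p : ℝ,
      (p : ℂ) * Complex.exp (Complex.I * (p : ℂ) * ((X t.toNNReal ω - Y s.toNNReal ω : ℝ) : ℂ))
        * Complex.exp (-((ε * p ^ 2 / 2 : ℝ) : ℂ))

/-- The real random variable `θ` is the derivative of the intersection local time of `X` and `Y`
on `[0,1]²`: it is the limit of the regularisations `θ_ε` as `ε ↓ 0`, almost surely and in `L^q`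
for every `0 < q < ∞`. -/
structure IsDILT {Ω : Type*} [MeasurableSpace Ω] (P : Measure Ω)
    (X Y : ℝ≥0 → Ω → ℝ) (θ : Ω → ℝ) : Prop where
  aemeasurable : AEMeasurable θ P
  tendsto_ae : ∀ᵐ ω ∂P,
    Tendsto (fun ε : ℝ => diltApprox X Y ε ω) (𝓝[>] 0) (𝓝 (θ ω : ℂ))
  tendsto_Lq : ∀ q : ℝ≥0∞, 0 < q → q < ∞ →
    Tendsto (fun ε : ℝ => eLpNorm (fun ω => diltApprox X Y ε ω - (θ ω : ℂ)) q P) (𝓝[>] 0) (𝓝 0)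

/-! The whole theorem rests on one moment estimate. For a weight `w`, let Θ_w be the integral of
w(p) exp(ip(X_t - Y_s)) over (0,1]² × ℝ. Expanding Θ_w^n and taking expectations inside leaves joint
characteristic functions at n times, which independence splits into an X-factor and a Y-factor with
the same frequencies. At ordered times each factor is at most ∏ exp(-c|u_j|^α r_j), where r_j are
the time increments and u_j the tail sums of the frequencies.

The constraint ∑ r_j ≤ 1 is removed by the tilt exp(lam(1 - ∑ r_j)) ≥ 1, so every time integral
becomes 1/(lam + c|u_j|^α). Orderings of the times cost n! twice: Cauchy–Schwarz over permutations
gives (n!)² times one squared kernel. Since p_j = u_j - u_{j+1}, a weight of size K(1+|p|)^a costs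
at most (1+|u_j|)^(2a) per variable, and the frequency integral becomes an n-th power, finite when
2a + 1 < 2α. For a = 1 this is α > 3/2. Taking lam = n gives |E Θ_w^n| ≤ (CK)^n n^(κn) for each κ ≤
2 with 2a + 1 < ακ (`enorm_integral_fourierLocalTime_pow_le_pow`); even moments then give ‖Θ_w‖ ≤
CK(2m)^κ in L^(2m) (`eLpNorm_fourierLocalTime_le`).

Because α > 3/2 is strict, a = 1 + 2δ is still allowed for small δ > 0. The variance derivative of
the Gaussian weight is then bounded by r^(δ-1)(1+|p|)^a, integrable in r near 0, which gives almost
sure convergence by the fundamental theorem of calculus; a δ-Hölder bound on differences of weights,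
with Fatou, gives convergence in L^q. With a = 1 the limit has moments of order C(2m)^κ for κ > 3/α,
so |θ|^β has exponential moments once κβ ≤ 1, which is possible exactly for β < α/3. -/

/-- Tonelli's theorem for a product of functions of one coordinate each. -/
theorem lintegral_pi_prod {n : ℕ} {E : Type*} [MeasurableSpace E] (μ : Measure E) [SigmaFinite μ]
    (f : Fin n → E → ℝ≥0∞) (hf : ∀ i, Measurable (f i)) :
    ∫⁻ x, ∏ i, f i (x i) ∂(Measure.pi fun _ : Fin n => μ) = ∏ i, ∫⁻ x, f i x ∂μ := by
  induction n with
  | zero => simp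
  | succ n ih =>
    have h := (measurePreserving_piFinSuccAbove (fun _ : Fin (n + 1) => μ) 0).symm
    rw [← h.lintegral_comp_emb (MeasurableEquiv.measurableEmbedding _)]
    simp only [Fin.prod_univ_succ]
    rw [← ih _ fun i => hf i.succ, ← lintegral_prod_mul (hf 0).aemeasurable]
    · rfl
    · exact (Finset.measurable_fun_prod _ fun i _ =>
        (hf i.succ).comp (measurable_pi_apply i)).aemeasurable

/-! ### Increment coordinates and volume-preserving changes of variables -/

/-- The matrix of `t ↦ (t₀, t₁ - t₀, t₂ - t₁, …)`. -/
def incMatrix (n : ℕ) : Matrix (Fin n) (Fin n) ℝ :=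
  fun j k => if j = k then 1 else if k.val + 1 = j.val then -1 else 0

theorem det_incMatrix (n : ℕ) : (incMatrix n).det = 1 := by
  rw [Matrix.det_of_isLowerTriangular]
  · exact Finset.prod_eq_one fun i _ => if_pos rfl
  · intro i j hij
    have h : i < j := hij
    have h1 : i ≠ j := h.ne
    have h2 : j.val + 1 ≠ i.val := by have : i.val < j.val := h; omega
    simp [incMatrix, h1, h2]

theorem incMatrix_mulVec_zero {n : ℕ} (t : Fin (n + 1) → ℝ) :
    (incMatrix (n + 1)).mulVec t 0 = t 0 := by
  have h : ∀ k : Fin (n + 1), incMatrix (n + 1) 0 k * t k = (if 0 = k then t k else 0) := by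
    intro k
    unfold incMatrix
    simp only [Fin.ext_iff, Fin.val_zero]
    split_ifs <;> first | omega | contradiction | simp
  simp [Matrix.mulVec, dotProduct, h]

theorem incMatrix_mulVec_succ {n : ℕ} (t : Fin (n + 1) → ℝ) (j : Fin n) :
    (incMatrix (n + 1)).mulVec t j.succ = t j.succ - t j.castSucc := by
  have h : ∀ k : Fin (n + 1), incMatrix (n + 1) j.succ k * t k =
      (if j.succ = k then t k else 0) - (if j.castSucc = k then t k else 0) := by
    intro k
    unfold incMatrix
    simp only [Fin.ext_iff, Fin.val_succ, Fin.val_castSucc]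
    split_ifs <;> first | omega | simp
  simp [Matrix.mulVec, dotProduct, h]

theorem incMatrix_transpose_mulVec_last {n : ℕ} (u : Fin (n + 1) → ℝ) :
    (incMatrix (n + 1)).transpose.mulVec u (Fin.last n) = u (Fin.last n) := by
  have h : ∀ k : Fin (n + 1), incMatrix (n + 1) k (Fin.last n) * u k =
      (if Fin.last n = k then u k else 0) := by
    intro k
    have := k.is_lt
    unfold incMatrix
    simp only [Fin.ext_iff, Fin.val_last]
    split_ifs <;> first | omega | simp
  simp [Matrix.mulVec, dotProduct, h]

theorem incMatrix_transpose_mulVec_castSucc {n : ℕ} (u : Fin (n + 1) → ℝ) (j : Fin n) :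
    (incMatrix (n + 1)).transpose.mulVec u j.castSucc = u j.castSucc - u j.succ := by
  have h : ∀ k : Fin (n + 1), incMatrix (n + 1) k j.castSucc * u k =
      (if j.castSucc = k then u k else 0) - (if j.succ = k then u k else 0) := by
    intro k
    unfold incMatrix
    simp only [Fin.ext_iff, Fin.val_succ, Fin.val_castSucc]
    split_ifs <;> first | omega | simp
  simp [Matrix.mulVec, dotProduct, h]

theorem sum_incMatrix_mulVec {n : ℕ} (t : Fin (n + 1) → ℝ) :
    ∑ j, (incMatrix (n + 1)).mulVec t j = t (Fin.last n) := by
  rw [Fin.sum_univ_succ, incMatrix_mulVec_zero]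
  simp only [incMatrix_mulVec_succ]
  have h1 := Fin.sum_univ_succ t
  have h2 := Fin.sum_univ_castSucc t
  rw [Finset.sum_sub_distrib]
  linarith

/-- Summation by parts. -/
theorem sum_mul_eq_sum_incMatrix {n : ℕ} (u x : Fin n → ℝ) :
    ∑ j, (incMatrix n).transpose.mulVec u j * x j = ∑ j, u j * (incMatrix n).mulVec x j := by
  have := Matrix.dotProduct_mulVec u (incMatrix n) x
  rw [← Matrix.mulVec_transpose] at this
  exact this.symm

/-- A linear change of variables of determinant one preserves Lebesgue measure. -/
theorem measurePreserving_mulVec_of_det_eq_one {ι : Type*} [Fintype ι] [DecidableEq ι]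
    {M : Matrix ι ι ℝ} (hM : M.det = 1) :
    MeasurePreserving (fun x : ι → ℝ => M.mulVec x) volume volume := by
  refine ⟨?_, ?_⟩
  · exact (Matrix.toLin' M).continuous_of_finiteDimensional.measurable
  · have := Real.map_matrix_volume_pi_eq_smul_volume_pi (M := M) (by simp [hM])
    simp only [hM, inv_one, abs_one, ENNReal.ofReal_one, one_smul] at this
    exact this

/-- Permuting coordinates preserves Lebesgue measure. -/
theorem measurePreserving_comp_perm {ι : Type*} [Fintype ι] (σ : Equiv.Perm ι) :
    MeasurePreserving (fun x : ι → ℝ => x ∘ σ) volume volume := by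
  have := volume_measurePreserving_piCongrLeft (fun _ : ι => ℝ) σ.symm
  convert this using 1
  ext x i
  simp [MeasurableEquiv.coe_piCongrLeft, Equiv.piCongrLeft_apply]

/-! ### The dominating kernels and their time and frequency integrals -/

/-- One factor of the kernel: `exp (-(lam + c |u|^α) r)` for `r ≥ 0`, and `0` for `r < 0`. -/
@[irreducible] noncomputable def stepKernel (α c lam r u : ℝ) : ℝ≥0∞ :=
  Set.indicator (Set.Ici 0) (fun r => ENNReal.ofReal (Real.exp (-(lam + c * |u| ^ α) * r))) r

/-- Bound for the joint characteristic function of an `α`-stable process at increasing times `t`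
and frequencies `q`, tilted by `exp (lam (1 - t_last)) ≥ 1`. -/
@[irreducible] noncomputable def chainKernel (α c lam : ℝ) {n : ℕ} (t q : Fin n → ℝ) : ℝ≥0∞ :=
  ENNReal.ofReal (Real.exp lam) * ∏ j, stepKernel α c lam ((incMatrix n).mulVec t j)
    ((incMatrix n).transpose⁻¹.mulVec q j)

/-- The symmetrised kernel, which bounds the joint characteristic function at unordered times. -/
@[irreducible] noncomputable def symKernel (α c lam : ℝ) {n : ℕ} (t q : Fin n → ℝ) : ℝ≥0∞ :=
  ∑ σ : Equiv.Perm (Fin n), chainKernel α c lam (t ∘ σ) (q ∘ σ)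

theorem measurable_stepKernel (α c lam : ℝ) :
    Measurable (fun z : ℝ × ℝ => stepKernel α c lam z.1 z.2) := by
  unfold stepKernel
  have : (fun z : ℝ × ℝ => Set.indicator (Set.Ici 0)
      (fun r => ENNReal.ofReal (Real.exp (-(lam + c * |z.2| ^ α) * r))) z.1) =
      Set.indicator {z : ℝ × ℝ | 0 ≤ z.1}
        (fun z => ENNReal.ofReal (Real.exp (-(lam + c * |z.2| ^ α) * z.1))) := by
    ext z; simp [Set.indicator]
  rw [this]
  exact Measurable.indicator (by fun_prop) (measurableSet_le measurable_const measurable_fst)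

theorem measurable_mulVec {ι : Type*} [Fintype ι] (M : Matrix ι ι ℝ) (j : ι) :
    Measurable fun x : ι → ℝ => M.mulVec x j := by
  unfold Matrix.mulVec dotProduct; fun_prop

theorem measurable_chainKernel (α c lam : ℝ) (n : ℕ) :
    Measurable (fun z : (Fin n → ℝ) × (Fin n → ℝ) => chainKernel α c lam z.1 z.2) := by
  unfold chainKernel
  generalize (incMatrix n).transpose⁻¹ = U
  generalize incMatrix n = L
  refine Measurable.const_mul (Finset.measurable_fun_prod _ fun j _ => ?_) _
  have h1 : Measurable fun z : (Fin n → ℝ) × (Fin n → ℝ) => L.mulVec z.1 j :=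
    (measurable_mulVec L j).comp measurable_fst
  have h2 : Measurable fun z : (Fin n → ℝ) × (Fin n → ℝ) => U.mulVec z.2 j :=
    (measurable_mulVec U j).comp measurable_snd
  exact (measurable_stepKernel α c lam).comp (h1.prodMk h2)

theorem measurable_chainKernel_comp {α c lam : ℝ} {n : ℕ} {E : Type*} [MeasurableSpace E]
    {f g : E → Fin n → ℝ} (hf : Measurable f) (hg : Measurable g) :
    Measurable fun x => chainKernel α c lam (f x) (g x) :=
  (measurable_chainKernel α c lam n).comp (hf.prodMk hg)

theorem measurable_comp_perm {ι : Type*} (σ : Equiv.Perm ι) :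
    Measurable fun x : ι → ℝ => x ∘ σ :=
  measurable_pi_lambda _ fun i => measurable_pi_apply (σ i)

theorem measurable_symKernel_comp {α c lam : ℝ} {n : ℕ} {E : Type*} [MeasurableSpace E]
    {f g : E → Fin n → ℝ} (hf : Measurable f) (hg : Measurable g) :
    Measurable fun x => symKernel α c lam (f x) (g x) := by
  unfold symKernel
  exact Finset.measurable_fun_sum _ fun σ _ =>
    measurable_chainKernel_comp ((measurable_comp_perm σ).comp hf) ((measurable_comp_perm σ).comp hg)

theorem lintegral_stepKernel {α c lam : ℝ} (hc : 0 ≤ c) (hlam : 0 < lam) (u : ℝ) :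
    ∫⁻ r, stepKernel α c lam r u = ENNReal.ofReal (lam + c * |u| ^ α)⁻¹ := by
  have hb : 0 < lam + c * |u| ^ α := by positivity
  unfold stepKernel
  rw [lintegral_indicator measurableSet_Ici, setLIntegral_congr Ioi_ae_eq_Ici.symm,
    ← ofReal_integral_eq_lintegral_ofReal]
  · rw [integral_exp_mul_Ioi (by linarith) 0]
    congr 1
    rw [mul_zero, Real.exp_zero, neg_div_neg_eq, one_div]
  · exact integrableOn_exp_mul_Ioi (by linarith) 0
  · exact ae_of_all _ fun x => (Real.exp_pos _).le

theorem lintegral_chainKernel {α c lam : ℝ} (hc : 0 ≤ c) (hlam : 0 < lam) {n : ℕ}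
    (q : Fin n → ℝ) :
    ∫⁻ t, chainKernel α c lam t q = ENNReal.ofReal (Real.exp lam) *
      ∏ j, ENNReal.ofReal (lam + c * |(incMatrix n).transpose⁻¹.mulVec q j| ^ α)⁻¹ := by
  have hm : ∀ u, Measurable fun r => stepKernel α c lam r u := fun u =>
    (measurable_stepKernel α c lam).comp (measurable_id.prodMk measurable_const)
  have hm' : Measurable fun r : Fin n → ℝ =>
      ∏ j, stepKernel α c lam (r j) ((incMatrix n).transpose⁻¹.mulVec q j) :=
    Finset.measurable_fun_prod _ fun j _ => (hm _).comp (measurable_pi_apply j)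
  unfold chainKernel
  generalize (incMatrix n).transpose⁻¹.mulVec q = v at hm' ⊢
  have hL := measurePreserving_mulVec_of_det_eq_one (det_incMatrix n)
  generalize incMatrix n = L at hL ⊢
  have hm'' : Measurable fun t => ∏ j, stepKernel α c lam (L.mulVec t j) (v j) :=
    hm'.comp hL.measurable
  rw [lintegral_const_mul _ hm'']
  rw [hL.lintegral_comp hm', volume_pi, lintegral_pi_prod _ _ fun _ => hm _]
  simp_rw [lintegral_stepKernel hc hlam]

theorem lintegral_symKernel {α c lam : ℝ} (hc : 0 ≤ c) (hlam : 0 < lam) {n : ℕ}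
    (q : Fin n → ℝ) :
    ∫⁻ t, symKernel α c lam t q = ∑ σ : Equiv.Perm (Fin n), ENNReal.ofReal (Real.exp lam) *
      ∏ j, ENNReal.ofReal (lam + c * |(incMatrix n).transpose⁻¹.mulVec (q ∘ σ) j| ^ α)⁻¹ := by
  unfold symKernel
  have hm : ∀ q : Fin n → ℝ, Measurable fun t => chainKernel α c lam t q := fun q =>
    measurable_chainKernel_comp measurable_id measurable_const
  have hm' : ∀ σ : Equiv.Perm (Fin n),
      Measurable fun t => chainKernel α c lam (t ∘ σ) (q ∘ σ) := fun σ =>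
    (hm _).comp (measurable_comp_perm σ)
  rw [lintegral_finsetSum _ fun σ _ => hm' σ]
  refine Finset.sum_congr rfl fun σ _ => ?_
  rw [← lintegral_chainKernel hc hlam,
    (measurePreserving_comp_perm σ).lintegral_comp (hm (q ∘ σ))]

theorem sq_sum_le_card_mul_sum_sq_ennreal {ι : Type*} [Fintype ι] (f : ι → ℝ≥0∞) :
    (∑ i, f i) ^ 2 ≤ Fintype.card ι * ∑ i, f i ^ 2 := by
  have := ENNReal.inner_le_Lp_mul_Lq Finset.univ f (fun _ => 1) (p := 2) (q := 2)
    ⟨by norm_num, by norm_num, by norm_num⟩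
  have h2 := pow_le_pow_left' this 2
  have hs : ∀ x : ℝ≥0∞, (x ^ (1 / 2 : ℝ)) ^ 2 = x := fun x => by
    rw [← ENNReal.rpow_natCast, ← ENNReal.rpow_mul]; norm_num
  rw [mul_pow, hs, hs] at h2
  simpa [mul_comm] using h2

theorem one_add_abs_sub_le (x y : ℝ) : 1 + |x - y| ≤ (1 + |x|) * (1 + |y|) := by
  have := abs_sub x y
  nlinarith [mul_nonneg (abs_nonneg x) (abs_nonneg y)]

/-- Each |u_j - u_{j+1}| is split submultiplicatively, and every u_j occurs in at most two
consecutive differences. This doubling is the source of the exponent 2a in `freqIntegral`. -/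
theorem prod_one_add_abs_incMatrix_transpose_le {n : ℕ} (u : Fin n → ℝ) :
    ∏ j, (1 + |(incMatrix n).transpose.mulVec u j|) ≤ ∏ j, (1 + |u j|) ^ 2 := by
  cases n with
  | zero => simp
  | succ n =>
    have hp : 0 ≤ ∏ j : Fin n, (1 + |u j.castSucc|) := by positivity
    have h1 : ∏ j : Fin n, (1 + |(incMatrix (n + 1)).transpose.mulVec u j.castSucc|) ≤
        (∏ j : Fin n, (1 + |u j.castSucc|)) * ∏ j : Fin n, (1 + |u j.succ|) := by
      rw [← Finset.prod_mul_distrib]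
      refine Finset.prod_le_prod (fun _ _ => by positivity) fun j _ => ?_
      rw [incMatrix_transpose_mulVec_castSucc]
      exact one_add_abs_sub_le _ _
    have h0 : ∏ j : Fin n, (1 + |u j.succ|) ≤ ∏ j, (1 + |u j|) := by
      rw [Fin.prod_univ_succ]
      exact le_mul_of_one_le_left (by positivity) (by linarith [abs_nonneg (u 0)])
    rw [Finset.prod_pow, Fin.prod_univ_castSucc, incMatrix_transpose_mulVec_last, sq]
    nth_rw 2 [Fin.prod_univ_castSucc]
    calc _ ≤ ((∏ j : Fin n, (1 + |u j.castSucc|)) * ∏ j, (1 + |u j|)) * (1 + |u (Fin.last n)|) := by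
          gcongr; exact h1.trans (by gcongr)
      _ = _ := by ring

/-- The one-dimensional frequency integral. -/
@[irreducible] noncomputable def freqIntegral (α c a lam : ℝ) : ℝ≥0∞ :=
  ∫⁻ u : ℝ, ENNReal.ofReal ((1 + |u|) ^ (2 * a)) * ENNReal.ofReal (lam + c * |u| ^ α)⁻¹ ^ 2

/-- Cauchy–Schwarz over the n! permutations removes the cross terms; the remaining n! integrals
coincide because the weight is symmetric. In the tail-sum variables u, a change of determinant one,
the integrand is bounded by a product over coordinates. -/
theorem lintegral_prod_mul_sq_lintegral_symKernel_le {α c lam a K : ℝ} (hc : 0 ≤ c)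
    (hlam : 0 < lam) (ha : 0 ≤ a) (hK : 0 ≤ K) {W : ℝ → ℝ≥0∞} (hWm : Measurable W)
    (hW : ∀ p, W p ≤ ENNReal.ofReal (K * (1 + |p|) ^ a)) (n : ℕ) :
    ∫⁻ p : Fin n → ℝ, (∏ j, W (p j)) * (∫⁻ t, symKernel α c lam t p) ^ 2 ≤
      (n.factorial : ℝ≥0∞) ^ 2 * ENNReal.ofReal (Real.exp lam) ^ 2 * ENNReal.ofReal K ^ n *
        freqIntegral α c a lam ^ n := by
  set e := ENNReal.ofReal (Real.exp lam)
  set L := incMatrix n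
  have hdet : IsUnit L.transpose.det := by simp [L, det_incMatrix]
  let G : (Fin n → ℝ) → ℝ≥0∞ := fun q =>
    e * ∏ j, ENNReal.ofReal (lam + c * |L.transpose⁻¹.mulVec q j| ^ α)⁻¹
  have hGm : Measurable G := by
    refine Measurable.const_mul (Finset.measurable_fun_prod _ fun j _ => ?_) _
    have := measurable_mulVec L.transpose⁻¹ j
    fun_prop
  have hPm : Measurable fun p : Fin n → ℝ => ∏ j, W (p j) :=
    Finset.measurable_fun_prod _ fun j _ => hWm.comp (measurable_pi_apply j)
  have hPG : Measurable fun q => (∏ j, W (q j)) * G q ^ 2 := hPm.mul (hGm.pow_const 2)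
  have hJ : ∫⁻ q, (∏ j, W (q j)) * G q ^ 2 ≤
      e ^ 2 * ENNReal.ofReal K ^ n * freqIntegral α c a lam ^ n := by
    rw [← (measurePreserving_mulVec_of_det_eq_one (M := L.transpose)
      (by simp [L, det_incMatrix])).lintegral_comp hPG]
    have hpt : ∀ u : Fin n → ℝ, (∏ j, W (L.transpose.mulVec u j)) * G (L.transpose.mulVec u) ^ 2 ≤
        (e ^ 2 * ENNReal.ofReal K ^ n) * ∏ j, (ENNReal.ofReal ((1 + |u j|) ^ (2 * a)) *
          ENNReal.ofReal (lam + c * |u j| ^ α)⁻¹ ^ 2) := by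
      intro u
      have h1 : ∏ j, W (L.transpose.mulVec u j) ≤
          ENNReal.ofReal K ^ n * ∏ j, ENNReal.ofReal ((1 + |u j|) ^ (2 * a)) := by
        refine (Finset.prod_le_prod' fun j _ => hW _).trans ?_
        rw [← ENNReal.ofReal_prod_of_nonneg fun j _ => by positivity,
          ← ENNReal.ofReal_prod_of_nonneg fun j _ => by positivity, ← ENNReal.ofReal_pow hK,
          ← ENNReal.ofReal_mul (by positivity)]
        refine ENNReal.ofReal_le_ofReal ?_
        rw [Finset.prod_mul_distrib, Finset.prod_const, Finset.card_univ, Fintype.card_fin]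
        refine mul_le_mul_of_nonneg_left ?_ (by positivity)
        have := Real.rpow_le_rpow (by positivity) (prod_one_add_abs_incMatrix_transpose_le u) ha
        rw [← Real.finsetProd_rpow _ _ (fun _ _ => by positivity),
          ← Real.finsetProd_rpow _ _ (fun _ _ => by positivity)] at this
        refine this.trans (le_of_eq (Finset.prod_congr rfl fun j _ => ?_))
        rw [← Real.rpow_natCast, ← Real.rpow_mul (by positivity)]
        norm_num
      have h2 : G (L.transpose.mulVec u) = e * ∏ j, ENNReal.ofReal (lam + c * |u j| ^ α)⁻¹ := by
        simp only [G, Matrix.mulVec_mulVec, Matrix.nonsing_inv_mul _ hdet, Matrix.one_mulVec]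
      rw [h2, Finset.prod_mul_distrib, mul_pow, Finset.prod_pow]
      calc _ ≤ _ := mul_le_mul_left h1 _
        _ = _ := by ring
    refine (lintegral_mono hpt).trans (le_of_eq ?_)
    have hm : Measurable fun u : ℝ => ENNReal.ofReal ((1 + |u|) ^ (2 * a)) *
        ENNReal.ofReal (lam + c * |u| ^ α)⁻¹ ^ 2 := by fun_prop
    have hm' : Measurable fun u : Fin n → ℝ => ∏ j, (ENNReal.ofReal ((1 + |u j|) ^ (2 * a)) *
        ENNReal.ofReal (lam + c * |u j| ^ α)⁻¹ ^ 2) :=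
      Finset.measurable_fun_prod _ fun j _ => hm.comp (measurable_pi_apply j)
    rw [lintegral_const_mul _ hm', volume_pi, lintegral_pi_prod _ (fun _ u => _) fun _ => hm]
    simp [freqIntegral]
  have hσ : ∀ σ : Equiv.Perm (Fin n),
      ∫⁻ p, (∏ j, W (p j)) * G (p ∘ σ) ^ 2 = ∫⁻ q, (∏ j, W (q j)) * G q ^ 2 := by
    intro σ
    rw [← (measurePreserving_comp_perm σ).lintegral_comp hPG]
    refine lintegral_congr fun p => ?_
    simp only [Function.comp_apply]
    rw [Equiv.prod_comp σ fun j => W (p j)]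
  calc ∫⁻ p : Fin n → ℝ, (∏ j, W (p j)) * (∫⁻ t, symKernel α c lam t p) ^ 2
      ≤ ∫⁻ p : Fin n → ℝ, (n.factorial : ℝ≥0∞) *
          ∑ σ : Equiv.Perm (Fin n), (∏ j, W (p j)) * G (p ∘ σ) ^ 2 := by
        refine lintegral_mono fun p => ?_
        rw [← Finset.mul_sum, lintegral_symKernel hc hlam]
        have := sq_sum_le_card_mul_sum_sq_ennreal fun σ : Equiv.Perm (Fin n) => G (p ∘ σ)
        rw [Fintype.card_perm, Fintype.card_fin] at this
        calc _ ≤ _ := mul_le_mul_right this (∏ j, W (p j))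
          _ = _ := by ring
    _ = (n.factorial : ℝ≥0∞) * ∑ σ : Equiv.Perm (Fin n), ∫⁻ q, (∏ j, W (q j)) * G q ^ 2 := by
        have hm : ∀ σ : Equiv.Perm (Fin n),
            Measurable fun p : Fin n → ℝ => (∏ j, W (p j)) * G (p ∘ σ) ^ 2 := fun σ =>
          hPm.mul ((hGm.comp (measurable_comp_perm σ)).pow_const 2)
        rw [lintegral_const_mul _ (Finset.measurable_fun_sum _ fun σ _ => hm σ),
          lintegral_finsetSum _ fun σ _ => hm σ]
        simp_rw [hσ]
    _ ≤ (n.factorial : ℝ≥0∞) * ∑ _σ : Equiv.Perm (Fin n),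
          e ^ 2 * ENNReal.ofReal K ^ n * freqIntegral α c a lam ^ n := by
        gcongr
    _ = _ := by
        rw [Finset.sum_const, Finset.card_univ, Fintype.card_perm, Fintype.card_fin, nsmul_eq_mul]
        ring

theorem one_add_abs_rpow_le {α c : ℝ} (hα : 0 < α) (hc : 0 < c) (u : ℝ) :
    min 1 c * 2 ^ (-α) * (1 + |u|) ^ α ≤ 1 + c * |u| ^ α := by
  have h0 : 0 < min 1 c := lt_min one_pos hc
  have h1 : (1 + |u|) ^ α ≤ 2 ^ α * (1 + |u| ^ α) := by
    calc (1 + |u|) ^ α ≤ (2 * max 1 |u|) ^ α := by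
          refine Real.rpow_le_rpow (by positivity) ?_ hα.le
          linarith [le_max_left 1 |u|, le_max_right 1 |u|]
      _ = 2 ^ α * (max 1 |u|) ^ α := Real.mul_rpow (by norm_num) (by positivity)
      _ ≤ 2 ^ α * (1 + |u| ^ α) := by
          gcongr
          rcases max_choice 1 |u| with h | h <;> rw [h]
          · rw [Real.one_rpow]; linarith [Real.rpow_nonneg (abs_nonneg u) α]
          · linarith
  calc min 1 c * 2 ^ (-α) * (1 + |u|) ^ α ≤ min 1 c * 2 ^ (-α) * (2 ^ α * (1 + |u| ^ α)) := by
        gcongr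
    _ = min 1 c * (1 + |u| ^ α) := by
        rw [Real.rpow_neg (by norm_num)]; field_simp
    _ ≤ 1 + c * |u| ^ α := by
        have := Real.rpow_nonneg (abs_nonneg u) α
        nlinarith [min_le_left 1 c, mul_le_mul_of_nonneg_right (min_le_right 1 c) this]

/-- With x = lam + c|u|^α, write x⁻² = x^(κ-2) x^(-κ). The first factor uses x ≥ lam (hence κ ≤ 2)
and produces the decay in lam; the second uses x ≥ d(1+|u|)^α and leaves an integrable power exactly
when 2a + 1 < ακ. -/
theorem freqIntegral_le {α c a κ : ℝ} (hα : 0 < α) (hc : 0 < c) (hκ0 : 0 ≤ κ) (hκ2 : κ ≤ 2)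
    (hκ : 2 * a + 1 < α * κ) :
    ∃ C : ℝ, 0 ≤ C ∧ ∀ lam : ℝ, 1 ≤ lam →
      freqIntegral α c a lam ≤ ENNReal.ofReal (C * lam ^ (κ - 2)) := by
  have hint : Integrable (fun u : ℝ => (1 + ‖u‖) ^ (-(α * κ - 2 * a))) :=
    integrable_one_add_norm (by simp; linarith)
  set d := min 1 c * 2 ^ (-α) with hd
  have hd0 : 0 < d := mul_pos (lt_min one_pos hc) (by positivity)
  refine ⟨d ^ (-κ) * ∫ u : ℝ, (1 + ‖u‖) ^ (-(α * κ - 2 * a)),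
    mul_nonneg (by positivity) (integral_nonneg fun u => by positivity), fun lam hlam => ?_⟩
  have hlam0 : 0 < lam := by linarith
  have hpt : ∀ u : ℝ, ENNReal.ofReal ((1 + |u|) ^ (2 * a)) *
      ENNReal.ofReal (lam + c * |u| ^ α)⁻¹ ^ 2 ≤
      ENNReal.ofReal (d ^ (-κ) * lam ^ (κ - 2)) *
        ENNReal.ofReal ((1 + ‖u‖) ^ (-(α * κ - 2 * a))) := by
    intro u
    have hu : 0 ≤ c * |u| ^ α := by positivity
    set x := lam + c * |u| ^ α with hx
    have hx0 : 0 < x := by linarith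
    have hy : d * (1 + |u|) ^ α ≤ x := (one_add_abs_rpow_le hα hc u).trans (by linarith)
    rw [← ENNReal.ofReal_pow (by positivity), ← ENNReal.ofReal_mul (by positivity),
      ← ENNReal.ofReal_mul (by positivity)]
    refine ENNReal.ofReal_le_ofReal ?_
    have hsplit : x⁻¹ ^ 2 = x ^ (κ - 2) * x ^ (-κ) := by
      rw [← Real.rpow_add hx0, show κ - 2 + -κ = -2 by ring, Real.rpow_neg hx0.le, Real.rpow_two,
        inv_pow]
    have h1 : x ^ (κ - 2) ≤ lam ^ (κ - 2) :=
      Real.rpow_le_rpow_of_nonpos hlam0 (by linarith) (by linarith)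
    have h2 : x ^ (-κ) ≤ (d * (1 + |u|) ^ α) ^ (-κ) :=
      Real.rpow_le_rpow_of_nonpos (by positivity) hy (by linarith)
    have h3 : (d * (1 + |u|) ^ α) ^ (-κ) = d ^ (-κ) * (1 + |u|) ^ (-(α * κ)) := by
      rw [Real.mul_rpow hd0.le (by positivity), ← Real.rpow_mul (by positivity)]
      congr 2; ring
    rw [hsplit, Real.norm_eq_abs]
    calc (1 + |u|) ^ (2 * a) * (x ^ (κ - 2) * x ^ (-κ))
        ≤ (1 + |u|) ^ (2 * a) * (lam ^ (κ - 2) * (d ^ (-κ) * (1 + |u|) ^ (-(α * κ)))) := by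
          rw [← h3]; gcongr
      _ = d ^ (-κ) * lam ^ (κ - 2) * ((1 + |u|) ^ (2 * a) * (1 + |u|) ^ (-(α * κ))) := by ring
      _ = _ := by
          rw [← Real.rpow_add (by positivity)]
          congr 2; ring
  unfold freqIntegral
  refine (lintegral_mono hpt).trans ?_
  rw [lintegral_const_mul _ (by fun_prop),
    ← ofReal_integral_eq_lintegral_ofReal hint (ae_of_all _ fun u => by positivity),
    ← ENNReal.ofReal_mul (by positivity)]
  exact ENNReal.ofReal_le_ofReal (le_of_eq (by ring))

/-- The `n`-th kernel integral grows at most like `n ^ (κ n)`, for every `κ > (2 a + 1) / α`. -/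
theorem kernel_integral_le {α c a κ : ℝ} (hα : 0 < α) (hc : 0 < c) (ha : 0 ≤ a) (hκ0 : 0 ≤ κ)
    (hκ2 : κ ≤ 2) (hκ : 2 * a + 1 < α * κ) :
    ∃ C : ℝ, 0 ≤ C ∧ ∀ (K : ℝ) (_ : 0 ≤ K) (W : ℝ → ℝ≥0∞) (_ : Measurable W)
      (_ : ∀ p, W p ≤ ENNReal.ofReal (K * (1 + |p|) ^ a)) (n : ℕ) (_ : 1 ≤ n),
      ∫⁻ p : Fin n → ℝ, (∏ j, W (p j)) * (∫⁻ t, symKernel α c n t p) ^ 2 ≤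
        ENNReal.ofReal ((C * K) ^ n * (n : ℝ) ^ (κ * n)) := by
  obtain ⟨C, hC, hfreq⟩ := freqIntegral_le (a := a) hα hc hκ0 hκ2 hκ
  refine ⟨Real.exp 1 ^ 2 * C, by positivity, fun K hK W hWm hW n hn => ?_⟩
  have hn1 : (1 : ℝ) ≤ n := by exact_mod_cast hn
  have hn0 : (0 : ℝ) < n := by linarith
  -- With lam = n the tilt costs only e^(2n), while the frequency integrals contribute n^((κ-2)n),
  -- turning (n!)² ≤ n^(2n) into n^(κn).
  refine (lintegral_prod_mul_sq_lintegral_symKernel_le hc.le hn0 ha hK hWm hW n).trans ?_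
  have h1 : (n.factorial : ℝ≥0∞) ≤ ENNReal.ofReal ((n : ℝ) ^ n) := by
    rw [← ENNReal.ofReal_natCast]
    refine ENNReal.ofReal_le_ofReal ?_
    exact_mod_cast Nat.factorial_le_pow n
  calc _ ≤ ENNReal.ofReal ((n : ℝ) ^ n) ^ 2 * ENNReal.ofReal (Real.exp n) ^ 2 *
          ENNReal.ofReal K ^ n * ENNReal.ofReal (C * (n : ℝ) ^ (κ - 2)) ^ n := by
        gcongr; exact hfreq n hn1
    _ = ENNReal.ofReal ((((n : ℝ) ^ n) ^ 2) * Real.exp n ^ 2 * K ^ n *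
          (C * (n : ℝ) ^ (κ - 2)) ^ n) := by
        rw [← ENNReal.ofReal_pow (by positivity), ← ENNReal.ofReal_pow (by positivity),
          ← ENNReal.ofReal_pow (by positivity), ← ENNReal.ofReal_pow (by positivity),
          ← ENNReal.ofReal_mul (by positivity), ← ENNReal.ofReal_mul (by positivity),
          ← ENNReal.ofReal_mul (by positivity)]
    _ = _ := by
        congr 1
        have h2 : Real.exp n = Real.exp 1 ^ n := by rw [← Real.exp_nat_mul, mul_one]
        have h3 : ((n : ℝ) ^ (κ - 2)) ^ n * ((n : ℝ) ^ n) ^ 2 = (n : ℝ) ^ (κ * n) := by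
          rw [← Real.rpow_natCast, ← Real.rpow_mul hn0.le, ← pow_mul, ← Real.rpow_natCast,
            ← Real.rpow_add hn0]
          congr 1; push_cast; ring
        rw [h2, ← h3]
        ring

/-! ### Exponential decay of stable characteristic functions -/

theorem map_nat_mul_of_map_add_eq_mul {g : ℝ → ℝ}
    (hmul : ∀ s t, 0 < s → 0 < t → g (s + t) = g s * g t)
    {t : ℝ} (ht : 0 < t) (n : ℕ) :
    g ((n + 1 : ℕ) * t) = g t ^ (n + 1) := by
  induction n with
  | zero => simp
  | succ n ih =>
    rw [show ((n + 1 + 1 : ℕ) : ℝ) * t = (n + 1 : ℕ) * t + t by push_cast; ring,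
      hmul _ _ (by positivity) ht, ih, pow_succ (g t) (n + 1)]

theorem antitone_of_map_add_eq_mul {g : ℝ → ℝ} (h0 : ∀ t, 0 < t → 0 ≤ g t)
    (h1 : ∀ t, 0 < t → g t ≤ 1) (hmul : ∀ s t, 0 < s → 0 < t → g (s + t) = g s * g t)
    {s t : ℝ} (hs : 0 < s) (hst : s ≤ t) : g t ≤ g s := by
  rcases hst.eq_or_lt with rfl | hlt
  · exact le_rfl
  · have := hmul s (t - s) hs (by linarith)
    rw [add_sub_cancel] at this
    rw [this]
    exact mul_le_of_le_one_right (h0 s hs) (h1 _ (by linarith))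

/-- A multiplicative function with values in `[0, 1]` decays exponentially at the rate read off
at `1`. -/
theorem le_exp_of_map_add_eq_mul {g : ℝ → ℝ} (h0 : ∀ t, 0 < t → 0 ≤ g t)
    (h1 : ∀ t, 0 < t → g t ≤ 1) (hmul : ∀ s t, 0 < s → 0 < t → g (s + t) = g s * g t)
    {c : ℝ} (hc : 0 ≤ c) (hg : g 1 ≤ Real.exp (-c)) {t : ℝ}
    (ht : 0 < t) : g t ≤ Real.exp (-(c * t)) := by
  -- Monotonicity replaces continuity: compare g((N+1)t) = g(t)^(N+1) with g at the integer part of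
  -- (N+1)t, losing at most one unit of time. After the (N+1)-th root the loss is c/(N+1), which
  -- vanishes in the limit.
  have key : ∀ N : ℕ, g t ≤ Real.exp (-(c * t) + c / ((N : ℝ) + 1)) := by
    intro N
    have hN : (0 : ℝ) < (N : ℝ) + 1 := by positivity
    have hNt : 0 < ((N + 1 : ℕ) : ℝ) * t := by positivity
    have hbound : g ((N + 1 : ℕ) * t) ≤ Real.exp (-c * ((N + 1 : ℕ) * t - 1)) := by
      rcases Nat.eq_zero_or_pos ⌊((N + 1 : ℕ) : ℝ) * t⌋₊ with hm | hm
      · have : ((N + 1 : ℕ) : ℝ) * t < 1 := Nat.floor_eq_zero.1 hm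
        exact (h1 _ hNt).trans (Real.one_le_exp (by nlinarith))
      · obtain ⟨k, hk⟩ := Nat.exists_eq_succ_of_ne_zero hm.ne'
        have hfl := Nat.floor_le hNt.le
        have hlt := Nat.lt_floor_add_one (((N + 1 : ℕ) : ℝ) * t)
        have hgk := map_nat_mul_of_map_add_eq_mul hmul one_pos k
        rw [mul_one] at hgk
        rw [hk] at hfl hlt
        calc g ((N + 1 : ℕ) * t) ≤ g (k + 1 : ℕ) :=
              antitone_of_map_add_eq_mul h0 h1 hmul (by positivity) hfl
          _ = g 1 ^ (k + 1) := hgk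
          _ ≤ Real.exp (-c) ^ (k + 1) := pow_le_pow_left₀ (h0 1 one_pos) hg _
          _ = Real.exp (((k + 1 : ℕ) : ℝ) * -c) := (Real.exp_nat_mul _ _).symm
          _ ≤ _ := by
              refine Real.exp_le_exp.2 ?_
              have : ((N + 1 : ℕ) : ℝ) * t - 1 ≤ (k + 1 : ℕ) := by
                simp only [Nat.succ_eq_add_one] at hlt; linarith
              nlinarith
    rw [map_nat_mul_of_map_add_eq_mul hmul ht] at hbound
    refine le_of_pow_le_pow_left₀ (Nat.succ_ne_zero N) (Real.exp_pos _).le ?_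
    rw [← Real.exp_nat_mul]
    refine hbound.trans (Real.exp_le_exp.2 (le_of_eq ?_))
    push_cast
    field_simp
    ring
  have hlim : Tendsto (fun N : ℕ => Real.exp (-(c * t) + c / ((N : ℝ) + 1))) atTop
      (𝓝 (Real.exp (-(c * t) + 0))) := by
    refine (Real.continuous_exp.tendsto _).comp (Tendsto.add tendsto_const_nhds ?_)
    exact tendsto_const_nhds.div_atTop (tendsto_natCast_atTop_atTop.atTop_add tendsto_const_nhds)
  rw [add_zero] at hlim
  exact ge_of_tendsto' hlim key

theorem charFun_mul_charFun_of_isStrictlyStableLaw {α : ℝ} {ν : Measure ℝ} [IsProbabilityMeasure ν]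
    (h : IsStrictlyStableLaw α ν) {A B : ℝ} (hA : 0 < A) (hB : 0 < B) (u : ℝ) :
    charFun ν (A * u) * charFun ν (B * u) = charFun ν ((A ^ α + B ^ α) ^ (1 / α) * u) := by
  have h1 := congrArg (fun m => charFun m u) (h A B hA hB)
  simp only [charFun_map_mul] at h1
  have h2 : (ν.prod ν).map (fun z : ℝ × ℝ => A * z.1 + B * z.2) =
      (((ν.map (A * ·)).prod (ν.map (B * ·))).map fun z => z.1 + z.2) := by
    rw [Measure.map_prod_map _ _ (by fun_prop) (by fun_prop),
      Measure.map_map (by fun_prop) (by fun_prop)]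
    rfl
  have : IsProbabilityMeasure (ν.map (A * ·)) :=
    Measure.isProbabilityMeasure_map (by fun_prop)
  have : IsProbabilityMeasure (ν.map (B * ·)) :=
    Measure.isProbabilityMeasure_map (by fun_prop)
  rw [h2, charFun_map_add_prod_eq_mul, Pi.mul_apply, charFun_map_mul, charFun_map_mul] at h1
  exact h1

/-- The characteristic function of a nondegenerate symmetric strictly stable law. -/
theorem exists_norm_charFun_le_of_isStrictlyStableLaw {α : ℝ} (hα : 0 < α) {ν : Measure ℝ}
    [IsProbabilityMeasure ν] (h : IsStrictlyStableLaw α ν) (hsymm : ν.map (fun x => -x) = ν)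
    (hν : ν ≠ Measure.dirac 0) :
    ∃ c : ℝ, 0 < c ∧ ∀ u : ℝ, ‖charFun ν u‖ ≤ Real.exp (-(c * |u| ^ α)) := by
  -- In the variable y = |u|^α, strict stability becomes multiplicativity of the modulus.
  set g : ℝ → ℝ := fun y => ‖charFun ν (y ^ (1 / α))‖ with hg
  have h0 : ∀ t, 0 < t → 0 ≤ g t := fun t _ => norm_nonneg _
  have h1 : ∀ t, 0 < t → g t ≤ 1 := fun t _ => norm_charFun_le_one _
  have hmul : ∀ s t, 0 < s → 0 < t → g (s + t) = g s * g t := by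
    intro s t hs ht
    have := charFun_mul_charFun_of_isStrictlyStableLaw h (A := s ^ (1 / α)) (B := t ^ (1 / α))
      (by positivity) (by positivity) 1
    rw [← Real.rpow_mul hs.le, ← Real.rpow_mul ht.le, one_div_mul_cancel hα.ne', Real.rpow_one,
      Real.rpow_one, mul_one, mul_one, mul_one] at this
    simp only [hg, ← this, norm_mul]
  have habs : ∀ u : ℝ, ‖charFun ν |u|‖ = ‖charFun ν u‖ := by
    intro u
    rcases abs_choice u with hu | hu <;> rw [hu]
    simp
  have hgu : ∀ u : ℝ, u ≠ 0 → g (|u| ^ α) = ‖charFun ν u‖ := by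
    intro u hu
    simp only [hg]
    rw [← Real.rpow_mul (abs_nonneg u), mul_one_div_cancel hα.ne', Real.rpow_one, habs]
  -- If g(1) = 1 then g = 1 at all positive integers, hence everywhere by monotonicity. Symmetry
  -- makes the characteristic function φ real, so φ² = 1; stability with A = B = 1 writes every
  -- value of φ as such a square, so φ = 1 and the law is a point mass at 0.
  have hlt : g 1 < 1 := by
    refine lt_of_le_of_ne (h1 1 one_pos) fun hone => hν ?_
    have hnorm : ∀ u : ℝ, u ≠ 0 → ‖charFun ν u‖ = 1 := by
      intro u hu
      have hpos : 0 < |u| ^ α := Real.rpow_pos_of_pos (abs_pos.2 hu) _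
      rw [← hgu u hu]
      refine le_antisymm (h1 _ hpos) ?_
      have hk := map_nat_mul_of_map_add_eq_mul hmul one_pos ⌈|u| ^ α⌉₊
      rw [hone, one_pow, mul_one] at hk
      rw [← hk]
      refine antitone_of_map_add_eq_mul h0 h1 hmul hpos ?_
      push_cast
      linarith [Nat.le_ceil (|u| ^ α)]
    have hconj : ∀ u, charFun ν u = (starRingEnd ℂ) (charFun ν u) := by
      intro u
      rw [← charFun_neg]
      have : ν.map (fun x => -x) = ν.map ((-1 : ℝ) * ·) := by congr 1; ext x; ring
      conv_lhs => rw [← hsymm, this, charFun_map_mul]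
      rw [neg_one_mul]
    refine Measure.ext_of_charFun (funext fun u => ?_)
    rw [charFun_dirac, inner_zero_left, Complex.ofReal_zero, zero_mul, Complex.exp_zero]
    by_cases hu : u = 0
    · simp [hu]
    set d : ℝ := (1 + 1) ^ (1 / α) with hd
    have hd0 : 0 < d := by positivity
    have hsq := charFun_mul_charFun_of_isStrictlyStableLaw h one_pos one_pos (d⁻¹ * u)
    rw [Real.one_rpow, ← hd, ← mul_assoc d, mul_inv_cancel₀ hd0.ne', one_mul, one_mul] at hsq
    have hn := hnorm (d⁻¹ * u) (mul_ne_zero (inv_ne_zero hd0.ne') hu)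
    rw [← hsq]
    nth_rw 2 [hconj (d⁻¹ * u)]
    rw [Complex.mul_conj, Complex.normSq_eq_norm_sq, hn]
    simp
  -- The rate is -log g(1); when g(1) = 0 any positive rate serves, and 1 is taken.
  obtain ⟨c, hc, hgc⟩ : ∃ c : ℝ, 0 < c ∧ g 1 ≤ Real.exp (-c) := by
    rcases (h0 1 one_pos).eq_or_lt with hz | hz
    · exact ⟨1, one_pos, by rw [← hz]; positivity⟩
    · exact ⟨-Real.log (g 1), by linarith [Real.log_neg hz hlt], by rw [neg_neg, Real.exp_log hz]⟩
  refine ⟨c, hc, fun u => ?_⟩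
  by_cases hu : u = 0
  · simp [hu, hα.ne']
  · rw [← hgu u hu]
    exact le_exp_of_map_add_eq_mul h0 h1 hmul hc.le hgc
      (Real.rpow_pos_of_pos (abs_pos.2 hu) _)

/-- Exponential decay in time and frequency of the characteristic functions of increments. -/
def HasStableDecay {Ω : Type*} [MeasurableSpace Ω] (P : Measure Ω) (X : ℝ≥0 → Ω → ℝ)
    (α c : ℝ) : Prop :=
  ∀ (s t : ℝ≥0) (u : ℝ), s ≤ t → ‖∫ ω, Complex.exp (Complex.I * (u * (X t ω - X s ω) : ℝ)) ∂P‖ ≤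
    Real.exp (-(c * |u| ^ α) * ((t : ℝ) - s))

theorem integral_exp_eq_charFun {Ω : Type*} [MeasurableSpace Ω] {P : Measure Ω} {Y : Ω → ℝ}
    (hY : AEMeasurable Y P) (u : ℝ) :
    ∫ ω, Complex.exp (Complex.I * (u * Y ω : ℝ)) ∂P = charFun (P.map Y) u := by
  rw [charFun_apply_real, integral_map hY (by fun_prop)]
  congr with ω
  push_cast
  ring_nf

/-- Multiplicativity is used twice: in |u|^α at time 1, by stability, and then in t for fixed u, by
stationary independent increments. The second application has rate c|u|^α supplied by the first. -/
theorem IsSymmetricStableProcess.exists_hasStableDecay {Ω : Type*} [MeasurableSpace Ω]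
    {P : Measure Ω} [IsProbabilityMeasure P] {α : ℝ} (hα : 0 < α) {X : ℝ≥0 → Ω → ℝ}
    (hX : IsSymmetricStableProcess α P X) : ∃ c, 0 < c ∧ HasStableDecay P X α c := by
  have hm := hX.levy.measurable
  have hprob : ∀ t, IsProbabilityMeasure (P.map (X t)) := fun t =>
    Measure.isProbabilityMeasure_map (hm t).aemeasurable
  have hsymm : (P.map (X 1)).map (fun x => -x) = P.map (X 1) := by
    rw [Measure.map_map measurable_neg (hm 1)]
    exact hX.symmetric.map_eq
  have hne : P.map (X 1) ≠ Measure.dirac 0 := by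
    intro h
    refine hX.nondegenerate (ae_of_ae_map (hm 1).aemeasurable (p := fun x => x = 0) ?_)
    rw [h, ae_dirac_eq]
    exact Filter.eventually_pure.2 rfl
  obtain ⟨c, hc, hφ⟩ := exists_norm_charFun_le_of_isStrictlyStableLaw hα hX.stable hsymm hne
  refine ⟨c, hc, fun s t u hst => ?_⟩
  set g : ℝ → ℝ := fun y => ‖charFun (P.map (X y.toNNReal)) u‖ with hg
  have h0 : ∀ t, 0 < t → 0 ≤ g t := fun t _ => norm_nonneg _
  have h1 : ∀ t, 0 < t → g t ≤ 1 := fun t _ => norm_charFun_le_one _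
  have hmul : ∀ s t, 0 < s → 0 < t → g (s + t) = g s * g t := by
    intro s t hs ht
    have hind := hX.levy.indep_increments.indepFun_eval_sub (r := 0) (s := s.toNNReal)
      (t := (s + t).toNNReal) (zero_le) (Real.toNNReal_le_toNNReal (by linarith)) hX.levy.zero
    have h := hind.charFun_map_add_eq_mul (hm _).aemeasurable ((hm _).sub (hm _)).aemeasurable
    rw [add_sub_cancel] at h
    have h2 := (hX.levy.stationary_increments s.toNNReal t.toNNReal).map_eq
    rw [← Real.toNNReal_add hs.le ht.le] at h2
    simp only [hg]
    rw [h, Pi.mul_apply, norm_mul, ← h2]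
    rfl
  have hst' := hX.levy.stationary_increments s (t - s)
  rw [add_tsub_cancel_of_le hst] at hst'
  rw [integral_exp_eq_charFun (Y := fun ω => X t ω - X s ω) ((hm t).sub (hm s)).aemeasurable,
    hst'.map_eq]
  rcases hst.eq_or_lt with rfl | hlt
  · simpa using norm_charFun_le_one (μ := P.map (X 0)) u
  · have hpos : 0 < (t : ℝ) - s := sub_pos.2 (by exact_mod_cast hlt)
    have := le_exp_of_map_add_eq_mul h0 h1 hmul (c := c * |u| ^ α) (by positivity)
      (by simpa [hg] using hφ u) hpos
    simp only [hg, ← NNReal.coe_sub hst, Real.toNNReal_coe] at this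
    rwa [NNReal.coe_sub hst, ← neg_mul] at this

/-! ### Joint characteristic functions at several times -/

theorem incMatrix_mulVec_eq_sub {n : ℕ} (y : ℝ≥0 → ℝ) (hy : y 0 = 0) (s : Fin (n + 1) → ℝ≥0)
    (j : Fin (n + 1)) :
    (incMatrix (n + 1)).mulVec (fun j => y (s j)) j =
      y ((Fin.cons 0 s : Fin (n + 2) → ℝ≥0) j.succ) -
        y ((Fin.cons 0 s : Fin (n + 2) → ℝ≥0) j.castSucc) := by
  refine Fin.cases ?_ (fun k => ?_) j
  · rw [incMatrix_mulVec_zero]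
    simp [hy]
  · rw [incMatrix_mulVec_succ, Fin.cons_succ, ← Fin.succ_castSucc, Fin.cons_succ]

theorem monotone_cons_zero {n : ℕ} {s : Fin (n + 1) → ℝ≥0} (hs : Monotone s) :
    Monotone (Fin.cons 0 s : Fin (n + 2) → ℝ≥0) := by
  rw [Fin.monotone_iff_le_succ]
  intro i
  refine Fin.cases ?_ (fun k => ?_) i
  · simp
  · rw [Fin.cons_succ, ← Fin.succ_castSucc, Fin.cons_succ]
    exact hs (Fin.castSucc_lt_succ).le

/-- The factor exp(lam(1 - ∑ r_j)) is at least 1 on the simplex. Inserting it allows each r_j to be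
integrated over a full half-line later. -/
theorem prod_exp_le_exp_mul_prod {n : ℕ} {lam : ℝ} (hlam : 0 ≤ lam) (r v : Fin n → ℝ)
    (hr : ∑ j, r j ≤ 1) :
    ∏ j, Real.exp (-v j * r j) ≤ Real.exp lam * ∏ j, Real.exp (-(lam + v j) * r j) := by
  have h : ∀ j, -(lam + v j) * r j = -(lam * r j) + -v j * r j := fun j => by ring
  simp_rw [h, Real.exp_add]
  rw [Finset.prod_mul_distrib, ← mul_assoc]
  refine le_mul_of_one_le_left (by positivity) ?_
  rw [← Real.exp_sum, ← Real.exp_add, Finset.sum_neg_distrib, ← Finset.mul_sum]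
  exact Real.one_le_exp (by nlinarith)

section

variable {Ω : Type*} [MeasurableSpace Ω] {P : Measure Ω} [IsProbabilityMeasure P]

/-- Summation by parts turns the exponent into a combination of independent increments with
coefficients `u`, the tail sums of `q`. The increments add up to the last time, which is at most 1,
as the tilt requires. -/
theorem enorm_integral_exp_le_chainKernel {X : ℝ≥0 → Ω → ℝ} (hX : IsLevyProcess P X) {α c lam : ℝ}
    (hdecay : HasStableDecay P X α c) (hlam : 0 ≤ lam) {n : ℕ} {t : Fin n → ℝ}
    (hmono : Monotone t) (ht0 : ∀ j, 0 ≤ t j) (ht1 : ∀ j, t j ≤ 1) (q : Fin n → ℝ) :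
    ‖∫ ω, Complex.exp (Complex.I * (∑ j, q j * X (t j).toNNReal ω : ℝ)) ∂P‖ₑ ≤
      chainKernel α c lam t q := by
  cases n with
  | zero => simp [chainKernel, hlam]
  | succ n =>
    set L := incMatrix (n + 1) with hL
    have hdet : IsUnit L.transpose.det := by simp [hL, det_incMatrix]
    set u := L.transpose⁻¹.mulVec q with hu
    have hq : q = L.transpose.mulVec u := by
      rw [hu, Matrix.mulVec_mulVec, Matrix.mul_nonsing_inv _ hdet, Matrix.one_mulVec]
    set s : Fin (n + 1) → ℝ≥0 := fun j => (t j).toNNReal with hs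
    have hsmono : Monotone s := fun i j hij => Real.toNNReal_le_toNNReal (hmono hij)
    set τ : Fin (n + 2) → ℝ≥0 := Fin.cons 0 s with hτ
    have hτmono : Monotone τ := monotone_cons_zero hsmono
    have hr : ∀ j, L.mulVec t j = (τ j.succ : ℝ) - τ j.castSucc := by
      intro j
      have := incMatrix_mulVec_eq_sub (fun x : ℝ≥0 => (x : ℝ)) rfl s j
      have hst : (fun j => (s j : ℝ)) = t := funext fun j => Real.coe_toNNReal _ (ht0 j)
      rwa [hst] at this
    have hr0 : ∀ j, 0 ≤ L.mulVec t j := fun j => by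
      rw [hr, sub_nonneg]; exact_mod_cast hτmono (Fin.castSucc_lt_succ).le
    have hae : ∀ᵐ ω ∂P, ∑ j, q j * X (t j).toNNReal ω =
        ∑ j, u j * (X (τ j.succ) ω - X (τ j.castSucc) ω) := by
      filter_upwards [hX.zero] with ω hω
      rw [hq]
      refine (sum_mul_eq_sum_incMatrix u fun j => X (s j) ω).trans ?_
      exact Finset.sum_congr rfl fun j _ => by rw [incMatrix_mulVec_eq_sub (fun x => X x ω) hω s j]
    have hprod : ∫ ω, Complex.exp (Complex.I * (∑ j, q j * X (t j).toNNReal ω : ℝ)) ∂P =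
        ∏ j, ∫ ω, Complex.exp (Complex.I *
          (u j * (X (τ j.succ) ω - X (τ j.castSucc) ω) : ℝ)) ∂P := by
      rw [← (hX.indep_increments (n + 1) τ hτmono).integral_fun_prod_comp
        (f := fun j x => Complex.exp (Complex.I * (u j * x : ℝ)))
        (fun j => ((hX.measurable _).sub (hX.measurable _)).aemeasurable)
        (fun j => by fun_prop)]
      refine integral_congr_ae ?_
      filter_upwards [hae] with ω hω
      rw [hω, ← Complex.exp_sum]
      push_cast
      rw [Finset.mul_sum]
    have hnorm : ‖∫ ω, Complex.exp (Complex.I * (∑ j, q j * X (t j).toNNReal ω : ℝ)) ∂P‖ ≤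
        Real.exp lam * ∏ j, Real.exp (-(lam + c * |u j| ^ α) * L.mulVec t j) := by
      rw [hprod, norm_prod]
      refine le_trans (Finset.prod_le_prod (fun _ _ => norm_nonneg _) fun j _ =>
        (hdecay _ _ (u j) (hτmono (Fin.castSucc_lt_succ).le)).trans_eq (by rw [← hr])) ?_
      refine prod_exp_le_exp_mul_prod hlam _ (fun j => c * |u j| ^ α) ?_
      rw [sum_incMatrix_mulVec]
      exact ht1 _
    rw [← ofReal_norm]
    refine (ENNReal.ofReal_le_ofReal hnorm).trans (le_of_eq ?_)
    rw [ENNReal.ofReal_mul (by positivity), ENNReal.ofReal_prod_of_nonneg fun _ _ => by positivity]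
    unfold chainKernel
    congr 1
    refine Finset.prod_congr rfl fun j _ => ?_
    unfold stepKernel
    have hmem : L.mulVec t j ∈ Set.Ici (0 : ℝ) := hr0 j
    exact (Set.indicator_of_mem hmem fun r =>
      ENNReal.ofReal (Real.exp (-(lam + c * |u j| ^ α) * r))).symm

/-- The permutation that sorts the times contributes one term of the sum, and the other terms are
nonnegative. -/
theorem enorm_integral_exp_le_symKernel {X : ℝ≥0 → Ω → ℝ} (hX : IsLevyProcess P X) {α c lam : ℝ}
    (hdecay : HasStableDecay P X α c) (hlam : 0 ≤ lam) {n : ℕ} {t : Fin n → ℝ}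
    (ht0 : ∀ j, 0 ≤ t j) (ht1 : ∀ j, t j ≤ 1) (q : Fin n → ℝ) :
    ‖∫ ω, Complex.exp (Complex.I * (∑ j, q j * X (t j).toNNReal ω : ℝ)) ∂P‖ₑ ≤
      symKernel α c lam t q := by
  have h := enorm_integral_exp_le_chainKernel hX hdecay hlam (Tuple.monotone_sort t)
    (fun j => ht0 _) (fun j => ht1 _) (q ∘ Tuple.sort t)
  have hsum : ∀ ω, ∑ j, (q ∘ Tuple.sort t) j * X ((t ∘ Tuple.sort t) j).toNNReal ω =
      ∑ j, q j * X (t j).toNNReal ω := fun ω =>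
    Equiv.sum_comp (Tuple.sort t) fun j => q j * X (t j).toNNReal ω
  simp only [hsum] at h
  unfold symKernel
  exact h.trans (Finset.single_le_sum (f := fun σ : Equiv.Perm (Fin n) =>
    chainKernel α c lam (t ∘ σ) (q ∘ σ)) (fun _ _ => zero_le) (Finset.mem_univ _))

/-- The joint characteristic function of two independent processes. -/
theorem enorm_integral_exp_sub_le_symKernel_mul {X Y : ℝ≥0 → Ω → ℝ} (hX : IsLevyProcess P X)
    (hY : IsLevyProcess P Y) (hindep : IndepFun (fun ω t => X t ω) (fun ω t => Y t ω) P)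
    {α c lam : ℝ} (hdX : HasStableDecay P X α c) (hdY : HasStableDecay P Y α c) (hlam : 0 ≤ lam)
    {n : ℕ} {t s : Fin n → ℝ} (ht0 : ∀ j, 0 ≤ t j) (ht1 : ∀ j, t j ≤ 1) (hs0 : ∀ j, 0 ≤ s j)
    (hs1 : ∀ j, s j ≤ 1) (q : Fin n → ℝ) :
    ‖∫ ω, Complex.exp (Complex.I *
        (∑ j, q j * (X (t j).toNNReal ω - Y (s j).toNNReal ω) : ℝ)) ∂P‖ₑ ≤
      symKernel α c lam t q * symKernel α c lam s q := by
  have hf : ∀ a : ℝ, ∀ t : Fin n → ℝ, Measurable fun x : ℝ≥0 → ℝ =>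
      Complex.exp (Complex.I * (a * ∑ j, q j * x (t j).toNNReal : ℝ)) := fun a t => by fun_prop
  have hmul : ∫ ω, Complex.exp (Complex.I *
        (∑ j, q j * (X (t j).toNNReal ω - Y (s j).toNNReal ω) : ℝ)) ∂P =
      (∫ ω, Complex.exp (Complex.I * (1 * ∑ j, q j * X (t j).toNNReal ω : ℝ)) ∂P) *
        ∫ ω, Complex.exp (Complex.I * (-1 * ∑ j, q j * Y (s j).toNNReal ω : ℝ)) ∂P := by
    refine Eq.trans ?_ ((hindep.comp (hf 1 t) (hf (-1) s)).integral_fun_mul_eq_mul_integral ?_ ?_)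
    · refine integral_congr_ae (ae_of_all _ fun ω => ?_)
      simp only [Function.comp_apply]
      rw [← Complex.exp_add, ← mul_add, ← Complex.ofReal_add]
      congr 3
      rw [one_mul, neg_one_mul, ← sub_eq_add_neg, ← Finset.sum_sub_distrib]
      exact Finset.sum_congr rfl fun j _ => by ring
    · exact ((hf 1 t).comp (measurable_pi_lambda _ hX.measurable)).aestronglyMeasurable
    · exact ((hf (-1) s).comp (measurable_pi_lambda _ hY.measurable)).aestronglyMeasurable
  -- Reversing the sign of Y conjugates its characteristic function, so the modulus is unaffected.
  have hconj : ‖∫ ω, Complex.exp (Complex.I * (-1 * ∑ j, q j * Y (s j).toNNReal ω : ℝ)) ∂P‖ₑ =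
      ‖∫ ω, Complex.exp (Complex.I * (∑ j, q j * Y (s j).toNNReal ω : ℝ)) ∂P‖ₑ := by
    rw [← ofReal_norm, ← ofReal_norm, ← RCLike.norm_conj, ← integral_conj]
    congr 2
    refine integral_congr_ae (ae_of_all _ fun ω => ?_)
    simp only [← Complex.exp_conj, map_mul, Complex.conj_I, Complex.conj_ofReal]
    congr 1
    push_cast
    ring
  rw [hmul, enorm_mul, hconj]
  simp only [one_mul]
  gcongr
  · exact enorm_integral_exp_le_symKernel hX hdX hlam ht0 ht1 q
  · exact enorm_integral_exp_le_symKernel hY hdY hlam hs0 hs1 q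

end

/-! ### Fourier functionals of a random field and their moments -/

/-- Lebesgue measure on `(0, 1] × (0, 1] × ℝ`. -/
noncomputable def timeFreqMeasure : Measure (ℝ × ℝ × ℝ) :=
  (volume.restrict (Set.Ioc (0 : ℝ) 1)).prod ((volume.restrict (Set.Ioc (0 : ℝ) 1)).prod volume)

instance : SigmaFinite timeFreqMeasure := by unfold timeFreqMeasure; infer_instance

/-- The integrand of `fourierLocalTime`. -/
@[irreducible] noncomputable def fourierIntegrand {Ω : Type*} (D : ℝ × ℝ → Ω → ℝ) (w : ℝ → ℂ) (ω : Ω)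
    (z : ℝ × ℝ × ℝ) : ℂ :=
  w z.2.2 * Complex.exp (Complex.I * (z.2.2 * D (z.1, z.2.1) ω : ℝ))

/-- The Fourier-multiplier functional
`∫_{(0,1]²} ∫_ℝ w(p) exp (i p D_{t,s}) dp ds dt` of a two-parameter random field `D`. -/
noncomputable def fourierLocalTime {Ω : Type*} (D : ℝ × ℝ → Ω → ℝ) (w : ℝ → ℂ) (ω : Ω) : ℂ :=
  ∫ z, fourierIntegrand D w ω z ∂timeFreqMeasure

/-- The joint characteristic functions of `D` on `[0,1]²` are dominated by the symmetrised
kernels. -/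
def HasKernelBound {Ω : Type*} [MeasurableSpace Ω] (P : Measure Ω) (D : ℝ × ℝ → Ω → ℝ)
    (α c : ℝ) : Prop :=
  ∀ (lam : ℝ) (_ : 0 ≤ lam) (n : ℕ) (t s q : Fin n → ℝ), (∀ j, t j ∈ Set.Ioc (0 : ℝ) 1) →
    (∀ j, s j ∈ Set.Ioc (0 : ℝ) 1) →
    ‖∫ ω, Complex.exp (Complex.I * (∑ j, q j * D (t j, s j) ω : ℝ)) ∂P‖ₑ ≤
      symKernel α c lam t q * symKernel α c lam s q

theorem norm_fourierIntegrand {Ω : Type*} (D : ℝ × ℝ → Ω → ℝ) (w : ℝ → ℂ) (ω : Ω) (z : ℝ × ℝ × ℝ) :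
    ‖fourierIntegrand D w ω z‖ = ‖w z.2.2‖ := by
  rw [fourierIntegrand, norm_mul, mul_comm Complex.I, Complex.norm_exp_ofReal_mul_I, mul_one]

section

variable {Ω : Type*} [MeasurableSpace Ω] {P : Measure Ω} {D : ℝ × ℝ → Ω → ℝ}

theorem measurable_fourierIntegrand (hD : Measurable (Function.uncurry D)) {w : ℝ → ℂ}
    (hw : Measurable w) :
    Measurable fun a : Ω × (ℝ × ℝ × ℝ) => fourierIntegrand D w a.1 a.2 := by
  have h : Measurable fun a : Ω × (ℝ × ℝ × ℝ) => D (a.2.1, a.2.2.1) a.1 :=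
    hD.comp (by fun_prop : Measurable fun a : Ω × (ℝ × ℝ × ℝ) => ((a.2.1, a.2.2.1), a.1))
  unfold fourierIntegrand
  fun_prop

theorem integrable_timeFreqMeasure_of_freq {w : ℝ → ℂ} (hw : Integrable w) :
    Integrable (fun z : ℝ × ℝ × ℝ => w z.2.2) timeFreqMeasure := by
  unfold timeFreqMeasure
  exact (hw.comp_snd _).comp_snd _

theorem integrable_fourierIntegrand (hD : Measurable (Function.uncurry D)) {w : ℝ → ℂ}
    (hwm : Measurable w) (hw : Integrable w) (ω : Ω) :
    Integrable (fourierIntegrand D w ω) timeFreqMeasure :=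
  (integrable_timeFreqMeasure_of_freq hw).mono
    ((measurable_fourierIntegrand hD hwm).comp measurable_prodMk_left).aestronglyMeasurable
    (ae_of_all _ fun z => (norm_fourierIntegrand D w ω z).le)

/-- Regroups n triples as three n-vectors and then drops the restriction of the times to (0,1],
which only enlarges the integral. -/
theorem lintegral_pi_timeFreqMeasure {n : ℕ}
    {F : (Fin n → ℝ) → (Fin n → ℝ) → (Fin n → ℝ) → ℝ≥0∞}
    (hF : Measurable fun a : (Fin n → ℝ) × (Fin n → ℝ) × (Fin n → ℝ) => F a.1 a.2.1 a.2.2) :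
    ∫⁻ z, F (fun j => (z j).1) (fun j => (z j).2.1) (fun j => (z j).2.2)
        ∂(Measure.pi fun _ : Fin n => timeFreqMeasure) ≤
      ∫⁻ p, ∫⁻ s, ∫⁻ t, F t s p := by
  set τ : Measure ℝ := volume.restrict (Set.Ioc (0 : ℝ) 1) with hτ
  have h1 := measurePreserving_arrowProdEquivProdArrow ℝ (ℝ × ℝ) (Fin n) (fun _ => τ)
    (fun _ => τ.prod volume)
  have h2 := measurePreserving_arrowProdEquivProdArrow ℝ ℝ (Fin n) (fun _ => τ)
    (fun _ => (volume : Measure ℝ))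
  have h3 := ((MeasurePreserving.id (Measure.pi fun _ : Fin n => τ)).prod h2).comp h1
  have hle : (Measure.pi fun _ : Fin n => τ) ≤ volume := by
    rw [hτ, ← Measure.restrict_pi_pi]
    exact Measure.restrict_le_self
  have h4 := h3.lintegral_comp hF
  refine (le_of_eq h4).trans ?_
  rw [lintegral_prod_symm _ hF.aemeasurable, lintegral_prod_symm]
  · refine lintegral_mono fun p => ?_
    refine lintegral_mono' hle fun s => ?_
    exact lintegral_mono' hle fun t => le_rfl
  · refine Measurable.aemeasurable ?_
    exact (hF.comp measurable_swap).lintegral_prod_right'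

variable [IsProbabilityMeasure P]

/-- The n-th power is an n-fold integral, and Fubini applies because the integrand has modulus
∏|w(p_j)|. The kernels in t and s share the frequencies p, so integrating out both times yields a
square. -/
theorem enorm_integral_fourierLocalTime_pow_le (hD : Measurable (Function.uncurry D)) {α c : ℝ}
    (hker : HasKernelBound P D α c) {w : ℝ → ℂ} (hwm : Measurable w) (hw : Integrable w)
    {lam : ℝ} (hlam : 0 ≤ lam) (n : ℕ) :
    ‖∫ ω, fourierLocalTime D w ω ^ n ∂P‖ₑ ≤
      ∫⁻ p : Fin n → ℝ, (∏ j, ‖w (p j)‖ₑ) * (∫⁻ t, symKernel α c lam t p) ^ 2 := by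
  set μ := Measure.pi fun _ : Fin n => timeFreqMeasure with hμ
  have hpow : ∀ ω, fourierLocalTime D w ω ^ n =
      ∫ z, ∏ j, fourierIntegrand D w ω (z j) ∂μ := by
    intro ω
    rw [hμ, integral_fintype_prod_eq_pow (ι := Fin n) (fourierIntegrand D w ω), Fintype.card_fin]
    rfl
  have hmeas : Measurable fun a : Ω × (Fin n → ℝ × ℝ × ℝ) =>
      ∏ j, fourierIntegrand D w a.1 (a.2 j) := by
    refine Finset.measurable_fun_prod _ fun j _ => ?_
    exact (measurable_fourierIntegrand hD hwm).comp
      (by fun_prop : Measurable fun a : Ω × (Fin n → ℝ × ℝ × ℝ) => (a.1, a.2 j))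
  have hint : Integrable (Function.uncurry fun ω (z : Fin n → ℝ × ℝ × ℝ) =>
      ∏ j, fourierIntegrand D w ω (z j)) (P.prod μ) := by
    have h := Integrable.fintype_prod (μ := fun _ : Fin n => timeFreqMeasure)
      (f := fun _ z => w z.2.2) fun _ => integrable_timeFreqMeasure_of_freq hw
    refine (h.comp_snd P).mono hmeas.aestronglyMeasurable (ae_of_all _ fun a => ?_)
    simp only [Function.uncurry, norm_prod, norm_fourierIntegrand]
    exact le_rfl
  have hfac : ∀ z : Fin n → ℝ × ℝ × ℝ, ∫ ω, ∏ j, fourierIntegrand D w ω (z j) ∂P =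
      (∏ j, w (z j).2.2) *
        ∫ ω, Complex.exp (Complex.I * (∑ j, (z j).2.2 * D ((z j).1, (z j).2.1) ω : ℝ)) ∂P := by
    intro z
    rw [← integral_const_mul]
    congr with ω
    simp only [fourierIntegrand]
    rw [Finset.prod_mul_distrib, ← Complex.exp_sum, ← Finset.mul_sum]
    push_cast
    rfl
  have htime : ∀ᵐ z ∂μ, ∀ j, (z j).1 ∈ Set.Ioc (0 : ℝ) 1 ∧ (z j).2.1 ∈ Set.Ioc (0 : ℝ) 1 := by
    rw [ae_all_iff]
    intro j
    suffices h : ∀ᵐ z ∂timeFreqMeasure, z.1 ∈ Set.Ioc (0 : ℝ) 1 ∧ z.2.1 ∈ Set.Ioc (0 : ℝ) 1 from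
      (Measure.quasiMeasurePreserving_eval (fun _ : Fin n => timeFreqMeasure) j).ae h
    unfold timeFreqMeasure
    have hIoc : ∀ᵐ t ∂(volume.restrict (Set.Ioc (0 : ℝ) 1)), t ∈ Set.Ioc (0 : ℝ) 1 :=
      ae_restrict_mem measurableSet_Ioc
    refine Filter.Eventually.and ?_ ?_
    · exact Measure.quasiMeasurePreserving_fst.ae hIoc
    · exact Measure.quasiMeasurePreserving_snd.ae (Measure.quasiMeasurePreserving_fst.ae hIoc)
  have hsymm : ∀ {E : Type} [MeasurableSpace E] {f g : E → Fin n → ℝ}, Measurable f →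
      Measurable g → Measurable fun x => symKernel α c lam (f x) (g x) :=
    fun hf hg => measurable_symKernel_comp hf hg
  have hWm : Measurable fun p : Fin n → ℝ => ∏ j, ‖w (p j)‖ₑ :=
    Finset.measurable_fun_prod _ fun j _ => (hwm.comp (measurable_pi_apply j)).enorm
  calc ‖∫ ω, fourierLocalTime D w ω ^ n ∂P‖ₑ
      = ‖∫ z, ∫ ω, ∏ j, fourierIntegrand D w ω (z j) ∂P ∂μ‖ₑ := by
        simp_rw [hpow]
        rw [integral_integral_swap hint]
    _ ≤ ∫⁻ z, ‖∫ ω, ∏ j, fourierIntegrand D w ω (z j) ∂P‖ₑ ∂μ := enorm_integral_le_lintegral_enorm _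
    _ ≤ ∫⁻ z, (∏ j, ‖w (z j).2.2‖ₑ) *
          (symKernel α c lam (fun j => (z j).1) (fun j => (z j).2.2) *
            symKernel α c lam (fun j => (z j).2.1) (fun j => (z j).2.2)) ∂μ := by
        refine lintegral_mono_ae ?_
        filter_upwards [htime] with z hz
        rw [hfac, enorm_mul]
        have hprod : ‖∏ j, w (z j).2.2‖ₑ = ∏ j, ‖w (z j).2.2‖ₑ := by
          simp only [enorm_eq_nnnorm, nnnorm_prod, ENNReal.ofNNReal_finsetProd]
        rw [hprod]
        gcongr
        exact hker lam hlam n _ _ _ (fun j => (hz j).1) (fun j => (hz j).2)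
    _ ≤ ∫⁻ p : Fin n → ℝ, ∫⁻ s, ∫⁻ t, (∏ j, ‖w (p j)‖ₑ) *
          (symKernel α c lam t p * symKernel α c lam s p) := by
        refine lintegral_pi_timeFreqMeasure
          (F := fun t s p => (∏ j, ‖w (p j)‖ₑ) *
            (symKernel α c lam t p * symKernel α c lam s p)) ?_
        refine (hWm.comp (measurable_snd.comp measurable_snd)).mul (Measurable.mul ?_ ?_)
        · exact hsymm measurable_fst (measurable_snd.comp measurable_snd)
        · exact hsymm (measurable_fst.comp measurable_snd) (measurable_snd.comp measurable_snd)
    _ = _ := by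
        refine lintegral_congr fun p => ?_
        have hm : Measurable fun t => symKernel α c lam t p := hsymm measurable_id measurable_const
        have hinner : ∀ s : Fin n → ℝ, ∫⁻ t, (∏ j, ‖w (p j)‖ₑ) *
            (symKernel α c lam t p * symKernel α c lam s p) =
            (∏ j, ‖w (p j)‖ₑ) * (∫⁻ t, symKernel α c lam t p) * symKernel α c lam s p := by
          intro s
          rw [lintegral_const_mul _ (hm.mul_const _), lintegral_mul_const _ hm, mul_assoc]
        simp_rw [hinner]
        rw [lintegral_const_mul _ hm, sq, mul_assoc]

theorem enorm_integral_fourierLocalTime_pow_le_pow {α c a κ : ℝ} (hα : 0 < α) (hc : 0 < c)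
    (ha : 0 ≤ a) (hκ0 : 0 ≤ κ) (hκ2 : κ ≤ 2) (hκ : 2 * a + 1 < α * κ)
    (hD : Measurable (Function.uncurry D)) (hker : HasKernelBound P D α c) :
    ∃ C : ℝ, 0 ≤ C ∧ ∀ (K : ℝ) (_ : 0 ≤ K) (w : ℝ → ℂ) (_ : Measurable w) (_ : Integrable w)
      (_ : ∀ p, ‖w p‖ ≤ K * (1 + |p|) ^ a) (n : ℕ) (_ : 1 ≤ n),
      ‖∫ ω, fourierLocalTime D w ω ^ n ∂P‖ₑ ≤ ENNReal.ofReal ((C * K) ^ n * (n : ℝ) ^ (κ * n)) := by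
  obtain ⟨C, hC, h⟩ := kernel_integral_le hα hc ha hκ0 hκ2 hκ
  refine ⟨C, hC, fun K hK w hwm hw hbound n hn => ?_⟩
  refine (enorm_integral_fourierLocalTime_pow_le hD hker hwm hw (Nat.cast_nonneg n) n).trans ?_
  refine h K hK (fun p => ‖w p‖ₑ) hwm.enorm (fun p => ?_) n hn
  rw [← ofReal_norm]
  exact ENNReal.ofReal_le_ofReal (hbound p)

end

theorem norm_fourierLocalTime_le {Ω : Type*} (D : ℝ × ℝ → Ω → ℝ) (w : ℝ → ℂ) (ω : Ω) :
    ‖fourierLocalTime D w ω‖ ≤ ∫ z : ℝ × ℝ × ℝ, ‖w z.2.2‖ ∂timeFreqMeasure := by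
  refine (norm_integral_le_integral_norm _).trans (le_of_eq ?_)
  simp_rw [norm_fourierIntegrand]

theorem measurePreserving_neg_freq :
    MeasurePreserving (MeasurableEquiv.prodCongr (MeasurableEquiv.refl ℝ)
      (MeasurableEquiv.prodCongr (MeasurableEquiv.refl ℝ) (MeasurableEquiv.neg ℝ)))
      timeFreqMeasure timeFreqMeasure := by
  unfold timeFreqMeasure
  exact (MeasurePreserving.id _).prod
    ((MeasurePreserving.id _).prod (Measure.measurePreserving_neg volume))

/-- Conjugation is undone by the reflection p ↦ -p. Reality matters because the moment bound
controls E Θ^n, and only for real Θ and even n is this E|Θ|^n. -/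
theorem conj_fourierLocalTime {Ω : Type*} (D : ℝ × ℝ → Ω → ℝ) {w : ℝ → ℂ}
    (hsymm : ∀ p, (starRingEnd ℂ) (w p) = w (-p)) (ω : Ω) :
    (starRingEnd ℂ) (fourierLocalTime D w ω) = fourierLocalTime D w ω := by
  unfold fourierLocalTime
  rw [← integral_conj, ← measurePreserving_neg_freq.integral_comp']
  congr with z
  obtain ⟨t, s, p⟩ := z
  have : (MeasurableEquiv.prodCongr (MeasurableEquiv.refl ℝ)
      (MeasurableEquiv.prodCongr (MeasurableEquiv.refl ℝ) (MeasurableEquiv.neg ℝ))) (t, s, p) =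
      (t, s, -p) := rfl
  rw [this]
  simp only [fourierIntegrand, map_mul, hsymm, neg_neg, ← Complex.exp_conj, Complex.conj_I,
    Complex.conj_ofReal]
  congr 2
  push_cast
  ring

theorem fourierLocalTime_eq_ofReal {Ω : Type*} (D : ℝ × ℝ → Ω → ℝ) {w : ℝ → ℂ}
    (hsymm : ∀ p, (starRingEnd ℂ) (w p) = w (-p))
    (ω : Ω) : fourierLocalTime D w ω = ((fourierLocalTime D w ω).re : ℂ) :=
  (Complex.conj_eq_iff_re.1 (conj_fourierLocalTime D hsymm ω)).symm

section

variable {Ω : Type*} [MeasurableSpace Ω] {P : Measure Ω} {D : ℝ × ℝ → Ω → ℝ}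

theorem measurable_fourierLocalTime (hD : Measurable (Function.uncurry D)) {w : ℝ → ℂ}
    (hw : Measurable w) : Measurable (fourierLocalTime D w) :=
  (StronglyMeasurable.integral_prod_right'
    (measurable_fourierIntegrand hD hw).stronglyMeasurable).measurable

theorem fourierLocalTime_sub (hD : Measurable (Function.uncurry D)) {w w' : ℝ → ℂ}
    (hwm : Measurable w) (hw : Integrable w) (hwm' : Measurable w') (hw' : Integrable w') (ω : Ω) :
    fourierLocalTime D (fun p => w p - w' p) ω =
      fourierLocalTime D w ω - fourierLocalTime D w' ω := by
  unfold fourierLocalTime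
  rw [← integral_sub (integrable_fourierIntegrand hD hwm hw ω)
    (integrable_fourierIntegrand hD hwm' hw' ω)]
  congr with z
  simp only [fourierIntegrand]
  ring

variable [IsProbabilityMeasure P]

theorem lintegral_enorm_fourierLocalTime_pow (hD : Measurable (Function.uncurry D)) {w : ℝ → ℂ}
    (hwm : Measurable w) (hsymm : ∀ p, (starRingEnd ℂ) (w p) = w (-p)) (m : ℕ) :
    ∫⁻ ω, ‖fourierLocalTime D w ω‖ₑ ^ (2 * m) ∂P =
      ‖∫ ω, fourierLocalTime D w ω ^ (2 * m) ∂P‖ₑ := by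
  have hpow : ∀ ω, fourierLocalTime D w ω ^ (2 * m) =
      ((‖fourierLocalTime D w ω‖ ^ (2 * m) : ℝ) : ℂ) := by
    intro ω
    rw [fourierLocalTime_eq_ofReal D hsymm ω, ← Complex.ofReal_pow, Complex.norm_real,
      Real.norm_eq_abs, pow_mul, pow_mul, sq_abs]
  have hmeas := measurable_fourierLocalTime hD hwm
  have hint : Integrable (fun ω => ‖fourierLocalTime D w ω‖ ^ (2 * m)) P := by
    refine Integrable.of_bound (hmeas.norm.pow_const _).aestronglyMeasurable
      ((∫ z : ℝ × ℝ × ℝ, ‖w z.2.2‖ ∂timeFreqMeasure) ^ (2 * m)) (ae_of_all _ fun ω => ?_)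
    rw [norm_pow, norm_norm]
    exact pow_le_pow_left₀ (norm_nonneg _) (norm_fourierLocalTime_le D w ω) _
  have hnn : 0 ≤ ∫ ω, ‖fourierLocalTime D w ω‖ ^ (2 * m) ∂P :=
    integral_nonneg fun ω => by positivity
  have hof : ∫ ω, ((‖fourierLocalTime D w ω‖ ^ (2 * m) : ℝ) : ℂ) ∂P =
      ((∫ ω, ‖fourierLocalTime D w ω‖ ^ (2 * m) ∂P : ℝ) : ℂ) := integral_ofReal
  simp_rw [hpow]
  rw [hof, ← ofReal_norm, Complex.norm_real, Real.norm_of_nonneg hnn,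
    ofReal_integral_eq_lintegral_ofReal hint (ae_of_all _ fun ω => by positivity)]
  refine lintegral_congr fun ω => ?_
  rw [ENNReal.ofReal_pow (norm_nonneg _), ofReal_norm]

/-- `C` does not depend on `w`, and `K` enters linearly; estimates for differences and derivatives
of weights therefore pass directly to the functionals. -/
theorem eLpNorm_fourierLocalTime_le {α c a κ : ℝ} (hα : 0 < α) (hc : 0 < c)
    (ha : 0 ≤ a) (hκ0 : 0 ≤ κ) (hκ2 : κ ≤ 2) (hκ : 2 * a + 1 < α * κ)
    (hD : Measurable (Function.uncurry D)) (hker : HasKernelBound P D α c) :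
    ∃ C : ℝ, 0 ≤ C ∧ ∀ (K : ℝ) (_ : 0 ≤ K) (w : ℝ → ℂ) (_ : Measurable w) (_ : Integrable w)
      (_ : ∀ p, (starRingEnd ℂ) (w p) = w (-p)) (_ : ∀ p, ‖w p‖ ≤ K * (1 + |p|) ^ a)
      (m : ℕ) (_ : 1 ≤ m),
      eLpNorm (fourierLocalTime D w) (2 * m : ℕ) P ≤
        ENNReal.ofReal (C * K * ((2 * m : ℕ) : ℝ) ^ κ) := by
  obtain ⟨C, hC, h⟩ := enorm_integral_fourierLocalTime_pow_le_pow hα hc ha hκ0 hκ2 hκ hD hker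
  refine ⟨C, hC, fun K hK w hwm hw hsymm hbound m hm => ?_⟩
  have hm0 : 2 * m ≠ 0 := by omega
  have hn0 : (0 : ℝ) < (2 * m : ℕ) := by exact_mod_cast Nat.pos_of_ne_zero hm0
  have h1 := h K hK w hwm hw hbound (2 * m) (by omega)
  rw [← lintegral_enorm_fourierLocalTime_pow hD hwm hsymm] at h1
  rw [eLpNorm_eq_lintegral_rpow_enorm_toReal (by exact_mod_cast hm0) (ENNReal.natCast_ne_top _),
    ENNReal.toReal_natCast]
  simp_rw [ENNReal.rpow_natCast]
  refine (ENNReal.rpow_le_rpow h1 (by positivity)).trans (le_of_eq ?_)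
  rw [ENNReal.ofReal_rpow_of_nonneg (by positivity) (by positivity)]
  congr 1
  have hx : (C * K) ^ (2 * m) * ((2 * m : ℕ) : ℝ) ^ (κ * (2 * m : ℕ)) =
      (C * K * ((2 * m : ℕ) : ℝ) ^ κ) ^ (2 * m) := by
    rw [Real.rpow_mul_natCast hn0.le, ← mul_pow]
  rw [hx, one_div, Real.pow_rpow_inv_natCast (by positivity) hm0]

end

/-! ### Gaussian weights and their dependence on the variance -/

/-- The Fourier multiplier of `ρ_ε'`, where `ρ_ε` is the centred Gaussian density of variance
`ε`. -/
@[irreducible] noncomputable def gaussDerivWeight (ε p : ℝ) : ℂ :=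
  Complex.I / (2 * (Real.pi : ℂ)) * ((p * Real.exp (-(ε * p ^ 2 / 2)) : ℝ) : ℂ)

/-- The derivative of `gaussDerivWeight` in the variance. -/
@[irreducible] noncomputable def gaussDerivWeightDeriv (r p : ℝ) : ℂ :=
  Complex.I / (2 * (Real.pi : ℂ)) * ((p * (-(p ^ 2 / 2) * Real.exp (-(r * p ^ 2 / 2))) : ℝ) : ℂ)

theorem measurable_gaussDerivWeight (ε : ℝ) : Measurable (gaussDerivWeight ε) := by
  unfold gaussDerivWeight; fun_prop

theorem measurable_uncurry_gaussDerivWeightDeriv :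
    Measurable (Function.uncurry gaussDerivWeightDeriv) := by
  unfold gaussDerivWeightDeriv Function.uncurry; fun_prop

theorem measurable_gaussDerivWeightDeriv (r : ℝ) : Measurable (gaussDerivWeightDeriv r) := by
  unfold gaussDerivWeightDeriv; fun_prop

theorem conj_I_div_two_pi_mul (x : ℝ) :
    (starRingEnd ℂ) (Complex.I / (2 * (Real.pi : ℂ)) * (x : ℂ)) =
      Complex.I / (2 * (Real.pi : ℂ)) * ((-x : ℝ) : ℂ) := by
  simp only [map_mul, map_div₀, Complex.conj_I, Complex.conj_ofReal, map_ofNat,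
    Complex.ofReal_neg]
  ring

theorem conj_gaussDerivWeight (ε p : ℝ) :
    (starRingEnd ℂ) (gaussDerivWeight ε p) = gaussDerivWeight ε (-p) := by
  unfold gaussDerivWeight
  rw [conj_I_div_two_pi_mul, neg_sq, neg_mul]

theorem conj_gaussDerivWeightDeriv (ε p : ℝ) :
    (starRingEnd ℂ) (gaussDerivWeightDeriv ε p) = gaussDerivWeightDeriv ε (-p) := by
  unfold gaussDerivWeightDeriv
  rw [conj_I_div_two_pi_mul, neg_sq, neg_mul p]

theorem norm_I_div_two_pi_mul_le (x : ℝ) :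
    ‖Complex.I / (2 * (Real.pi : ℂ)) * (x : ℂ)‖ ≤ |x| := by
  rw [norm_mul, norm_div, Complex.norm_I, norm_mul, Complex.norm_real, Complex.norm_real,
    Real.norm_eq_abs, Real.norm_eq_abs, abs_of_pos Real.pi_pos]
  refine mul_le_of_le_one_left (abs_nonneg x) ?_
  rw [Complex.norm_ofNat, div_le_one (by positivity)]
  nlinarith [Real.pi_gt_three]

theorem integrable_pow_mul_exp_neg_mul_sq {ε : ℝ} (hε : 0 < ε) (k : ℕ) :
    Integrable fun p : ℝ => p ^ k * Real.exp (-(ε * p ^ 2 / 2)) := by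
  have h := integrable_rpow_mul_exp_neg_mul_sq (b := ε / 2) (by positivity) (s := k)
    (by have : (0 : ℝ) ≤ k := Nat.cast_nonneg k
        linarith)
  refine h.congr (ae_of_all _ fun p => ?_)
  simp only [Real.rpow_natCast]
  congr 2
  ring

theorem integrable_gaussDerivWeight {ε : ℝ} (hε : 0 < ε) : Integrable (gaussDerivWeight ε) := by
  unfold gaussDerivWeight
  refine Integrable.const_mul
    (Integrable.ofReal (𝕜 := ℂ) (f := fun p => p * Real.exp (-(ε * p ^ 2 / 2))) ?_) _
  simpa using integrable_pow_mul_exp_neg_mul_sq hε 1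

theorem integrable_gaussDerivWeightDeriv {r : ℝ} (hr : 0 < r) :
    Integrable (gaussDerivWeightDeriv r) := by
  unfold gaussDerivWeightDeriv
  refine Integrable.const_mul
    (Integrable.ofReal (𝕜 := ℂ) (f := fun p => p * (-(p ^ 2 / 2) * Real.exp (-(r * p ^ 2 / 2)))) ?_) _
  refine ((integrable_pow_mul_exp_neg_mul_sq hr 3).const_mul (-(1 / 2))).congr
    (ae_of_all _ fun p => ?_)
  ring

theorem abs_mul_abs_rpow_le {δ : ℝ} (hδ : 0 ≤ δ) (p : ℝ) :
    |p| * |p| ^ (2 * δ) ≤ (1 + |p|) ^ (1 + 2 * δ) := by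
  have hp : 0 ≤ |p| := abs_nonneg p
  rw [Real.rpow_add (by positivity), Real.rpow_one]
  gcongr <;> linarith

theorem sq_rpow_eq (p δ : ℝ) : (p ^ 2) ^ δ = |p| ^ (2 * δ) := by
  rw [← sq_abs, ← Real.rpow_natCast, ← Real.rpow_mul (abs_nonneg p)]
  norm_num

theorem norm_gaussDerivWeight_le {ε : ℝ} (hε : 0 ≤ ε) (p : ℝ) :
    ‖gaussDerivWeight ε p‖ ≤ 1 * (1 + |p|) ^ (1 : ℝ) := by
  unfold gaussDerivWeight
  refine (norm_I_div_two_pi_mul_le _).trans ?_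
  rw [Real.rpow_one, one_mul, abs_mul, Real.abs_exp]
  have : Real.exp (-(ε * p ^ 2 / 2)) ≤ 1 := Real.exp_le_one_iff.2 (by simp; positivity)
  nlinarith [abs_nonneg p]

/-- Interpolates between the trivial bound 1 and the Lipschitz bound |x - y|. -/
theorem abs_exp_neg_sub_exp_neg_le {x y δ : ℝ} (hx : 0 ≤ x) (hy : 0 ≤ y) (hδ0 : 0 ≤ δ)
    (hδ1 : δ ≤ 1) : |Real.exp (-x) - Real.exp (-y)| ≤ |x - y| ^ δ := by
  wlog hxy : x ≤ y generalizing x y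
  · rw [abs_sub_comm, abs_sub_comm x]
    exact this hy hx (le_of_not_ge hxy)
  have h1 : Real.exp (-y) ≤ Real.exp (-x) := Real.exp_le_exp.2 (by linarith)
  rw [abs_of_nonneg (by linarith), abs_of_nonpos (by linarith), neg_sub]
  have hx1 : Real.exp (-x) ≤ 1 := Real.exp_le_one_iff.2 (by linarith)
  rcases le_total 1 (y - x) with h | h
  · have := Real.one_le_rpow h hδ0
    linarith [Real.exp_pos (-y)]
  · have h2 : y - x ≤ (y - x) ^ δ := by
      have := Real.rpow_le_rpow_of_exponent_ge' (by linarith) h hδ0 hδ1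
      rwa [Real.rpow_one] at this
    have h3 : Real.exp (-y) = Real.exp (-x) * Real.exp (-(y - x)) := by
      rw [← Real.exp_add]; congr 1; ring
    have h4 := Real.add_one_le_exp (-(y - x))
    have h5 := Real.exp_pos (-x)
    nlinarith

theorem norm_gaussDerivWeight_sub_le {ε η δ : ℝ} (hε : 0 ≤ ε) (hη : 0 ≤ η) (hδ0 : 0 ≤ δ)
    (hδ1 : δ ≤ 1) (p : ℝ) :
    ‖gaussDerivWeight ε p - gaussDerivWeight η p‖ ≤ |ε - η| ^ δ * (1 + |p|) ^ (1 + 2 * δ) := by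
  unfold gaussDerivWeight
  rw [← mul_sub, ← Complex.ofReal_sub, ← mul_sub]
  refine (norm_I_div_two_pi_mul_le _).trans ?_
  rw [abs_mul]
  have h := abs_exp_neg_sub_exp_neg_le (x := ε * p ^ 2 / 2) (y := η * p ^ 2 / 2) (δ := δ)
    (by positivity) (by positivity) hδ0 hδ1
  have h2 : |ε * p ^ 2 / 2 - η * p ^ 2 / 2| ^ δ ≤ |ε - η| ^ δ * |p| ^ (2 * δ) := by
    rw [← sq_rpow_eq, ← Real.mul_rpow (abs_nonneg _) (sq_nonneg p)]
    refine Real.rpow_le_rpow (abs_nonneg _) ?_ hδ0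
    rw [← sub_div, ← sub_mul, abs_div, abs_mul, abs_of_nonneg (sq_nonneg p), abs_two]
    have : 0 ≤ |ε - η| * p ^ 2 := by positivity
    linarith
  calc |p| * |Real.exp (-(ε * p ^ 2 / 2)) - Real.exp (-(η * p ^ 2 / 2))|
      ≤ |p| * (|ε - η| ^ δ * |p| ^ (2 * δ)) := by gcongr; exact h.trans h2
    _ = |ε - η| ^ δ * (|p| * |p| ^ (2 * δ)) := by ring
    _ ≤ _ := by gcongr; exact abs_mul_abs_rpow_le hδ0 p

/-- With x = rp², the exponential absorbs all but x^δ of the factor x. The outcome trades 2δ powers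
of frequency for r^(δ-1), integrable at 0 when δ > 0. -/
theorem norm_gaussDerivWeightDeriv_le {r δ : ℝ} (hr : 0 < r) (hδ0 : 0 ≤ δ) (hδ1 : δ ≤ 1) (p : ℝ) :
    ‖gaussDerivWeightDeriv r p‖ ≤ r ^ (δ - 1) * (1 + |p|) ^ (1 + 2 * δ) := by
  unfold gaussDerivWeightDeriv
  refine (norm_I_div_two_pi_mul_le _).trans ?_
  rw [abs_mul, abs_mul, abs_neg, Real.abs_exp, abs_of_nonneg (by positivity : 0 ≤ p ^ 2 / 2)]
  set x := r * p ^ 2 with hx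
  have hx0 : 0 ≤ x := by positivity
  have key : x / 2 * Real.exp (-(x / 2)) ≤ x ^ δ := by
    have h1 : x ≤ x ^ δ * (1 + x) := by
      rcases le_total 1 x with h | h
      · have := Real.one_le_rpow h hδ0
        nlinarith
      · have := Real.rpow_le_rpow_of_exponent_ge' hx0 h hδ0 hδ1
        rw [Real.rpow_one] at this
        nlinarith
    have h2 : 1 + x ≤ 2 * Real.exp (x / 2) := by linarith [Real.add_one_le_exp (x / 2)]
    have h3 : x ≤ x ^ δ * (2 * Real.exp (x / 2)) :=
      h1.trans (mul_le_mul_of_nonneg_left h2 (Real.rpow_nonneg hx0 δ))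
    rw [Real.exp_neg, ← div_eq_mul_inv, div_le_iff₀ (Real.exp_pos _)]
    linarith
  have key2 : p ^ 2 / 2 * Real.exp (-(x / 2)) ≤ r ^ (δ - 1) * |p| ^ (2 * δ) := by
    have : p ^ 2 / 2 = r⁻¹ * (x / 2) := by rw [hx]; field_simp
    rw [this, mul_assoc]
    calc r⁻¹ * (x / 2 * Real.exp (-(x / 2))) ≤ r⁻¹ * x ^ δ := by gcongr
      _ = r ^ (δ - 1) * |p| ^ (2 * δ) := by
        rw [hx, Real.mul_rpow hr.le (sq_nonneg p), sq_rpow_eq, Real.rpow_sub hr, Real.rpow_one]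
        ring
  calc |p| * (p ^ 2 / 2 * Real.exp (-(x / 2))) ≤ |p| * (r ^ (δ - 1) * |p| ^ (2 * δ)) := by gcongr
    _ = r ^ (δ - 1) * (|p| * |p| ^ (2 * δ)) := by ring
    _ ≤ _ := by gcongr; exact abs_mul_abs_rpow_le hδ0 p

theorem hasDerivAt_gaussDerivWeight (r p : ℝ) :
    HasDerivAt (fun r => gaussDerivWeight r p) (gaussDerivWeightDeriv r p) r := by
  unfold gaussDerivWeight gaussDerivWeightDeriv
  refine HasDerivAt.const_mul _ (HasDerivAt.ofReal_comp ?_)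
  refine HasDerivAt.const_mul _ ?_
  have h : HasDerivAt (fun r : ℝ => -(r * p ^ 2 / 2)) (-(p ^ 2 / 2)) r := by
    have := (((hasDerivAt_id r).mul_const (p ^ 2)).div_const 2).fun_neg
    simpa using this
  simpa [mul_comm] using h.exp

/-! ### Almost sure and L^q convergence, and moments of the limit -/

section

variable {Ω : Type*} [MeasurableSpace Ω] {P : Measure Ω} {D : ℝ × ℝ → Ω → ℝ}

theorem measurable_fourierIntegrand_gaussDerivWeightDeriv (hD : Measurable (Function.uncurry D)) :
    Measurable fun a : (ℝ × Ω) × (ℝ × ℝ × ℝ) =>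
      fourierIntegrand D (gaussDerivWeightDeriv a.1.1) a.1.2 a.2 := by
  have h : Measurable fun a : (ℝ × Ω) × (ℝ × ℝ × ℝ) => D (a.2.1, a.2.2.1) a.1.2 :=
    hD.comp (by fun_prop : Measurable fun a : (ℝ × Ω) × (ℝ × ℝ × ℝ) =>
      ((a.2.1, a.2.2.1), a.1.2))
  have h2 : Measurable fun a : (ℝ × Ω) × (ℝ × ℝ × ℝ) => gaussDerivWeightDeriv a.1.1 a.2.2.2 :=
    measurable_uncurry_gaussDerivWeightDeriv.comp
      (by fun_prop : Measurable fun a : (ℝ × Ω) × (ℝ × ℝ × ℝ) => (a.1.1, a.2.2.2))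
  unfold fourierIntegrand
  fun_prop

theorem measurable_fourierLocalTime_gaussDerivWeightDeriv (hD : Measurable (Function.uncurry D)) :
    Measurable fun a : ℝ × Ω => fourierLocalTime D (gaussDerivWeightDeriv a.1) a.2 :=
  (StronglyMeasurable.integral_prod_right'
    (measurable_fourierIntegrand_gaussDerivWeightDeriv hD).stronglyMeasurable).measurable

theorem norm_gaussDerivWeightDeriv_antitone {ε r : ℝ} (h : ε ≤ r) (p : ℝ) :
    ‖gaussDerivWeightDeriv r p‖ ≤ ‖gaussDerivWeightDeriv ε p‖ := by
  unfold gaussDerivWeightDeriv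
  rw [norm_mul, norm_mul (_ / _), Complex.norm_real, Complex.norm_real, norm_mul, norm_mul,
    norm_mul p, norm_mul (-_), Real.norm_eq_abs (Real.exp _), Real.norm_eq_abs (Real.exp _),
    Real.abs_exp, Real.abs_exp]
  gcongr

/-- The fundamental theorem of calculus in the variance parameter. -/
theorem fourierLocalTime_sub_eq_intervalIntegral (hD : Measurable (Function.uncurry D)) {ε : ℝ}
    (hε : 0 < ε) (hε1 : ε ≤ 1) (ω : Ω) :
    fourierLocalTime D (gaussDerivWeight 1) ω - fourierLocalTime D (gaussDerivWeight ε) ω =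
      ∫ r in ε..1, fourierLocalTime D (gaussDerivWeightDeriv r) ω := by
  rw [← fourierLocalTime_sub hD (measurable_gaussDerivWeight _)
    (integrable_gaussDerivWeight one_pos) (measurable_gaussDerivWeight _)
    (integrable_gaussDerivWeight hε)]
  have hftc : ∀ p, gaussDerivWeight 1 p - gaussDerivWeight ε p =
      ∫ r in ε..1, gaussDerivWeightDeriv r p := by
    intro p
    rw [intervalIntegral.integral_eq_sub_of_hasDerivAt fun r _ => hasDerivAt_gaussDerivWeight r p]
    refine Continuous.intervalIntegrable ?_ _ _
    unfold gaussDerivWeightDeriv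
    fun_prop
  have hmeas : Measurable fun a : ℝ × (ℝ × ℝ × ℝ) =>
      fourierIntegrand D (gaussDerivWeightDeriv a.1) ω a.2 :=
    (measurable_fourierIntegrand_gaussDerivWeightDeriv hD).comp
      (by fun_prop : Measurable fun a : ℝ × (ℝ × ℝ × ℝ) => ((a.1, ω), a.2))
  have hint : Integrable (Function.uncurry fun r z =>
      fourierIntegrand D (gaussDerivWeightDeriv r) ω z)
      ((volume.restrict (Set.Ioc ε 1)).prod timeFreqMeasure) := by
    -- For r ≥ ε the weight at ε dominates, which justifies Fubini on (ε,1].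
    refine ((integrable_timeFreqMeasure_of_freq
      (integrable_gaussDerivWeightDeriv hε)).comp_snd _).mono hmeas.aestronglyMeasurable ?_
    have hr : ∀ᵐ r ∂(volume.restrict (Set.Ioc ε 1)), r ∈ Set.Ioc ε 1 :=
      ae_restrict_mem measurableSet_Ioc
    filter_upwards [(Measure.quasiMeasurePreserving_fst (ν := timeFreqMeasure)).ae hr] with a ha
    simp only [Function.uncurry]
    rw [norm_fourierIntegrand]
    exact norm_gaussDerivWeightDeriv_antitone ha.1.le _
  rw [intervalIntegral.integral_of_le hε1]
  unfold fourierLocalTime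
  rw [integral_integral_swap hint]
  congr with z
  simp only [fourierIntegrand]
  rw [hftc, intervalIntegral.integral_of_le hε1, integral_mul_const]

/-- Fatou's lemma along a sequence tending to 0 from the right. -/
theorem eLpNorm_lim_le_of_eventually_le {f : ℝ → Ω → ℂ} {g : Ω → ℂ} {q : ℝ≥0∞} {B : ℝ≥0∞}
    (hf : ∀ η, AEStronglyMeasurable (f η) P)
    (hlim : ∀ᵐ ω ∂P, Tendsto (fun η => f η ω) (𝓝[>] 0) (𝓝 (g ω)))
    (hB : ∀ᶠ η in 𝓝[>] (0 : ℝ), eLpNorm (f η) q P ≤ B) : eLpNorm g q P ≤ B := by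
  obtain ⟨u, hu⟩ := exists_seq_tendsto (𝓝[>] (0 : ℝ))
  refine (Lp.eLpNorm_lim_le_liminf_eLpNorm (fun n => hf (u n)) g ?_).trans ?_
  · filter_upwards [hlim] with ω hω using hω.comp hu
  · exact liminf_le_of_frequently_le' (hu.eventually hB).frequently

variable [IsProbabilityMeasure P]

theorem lintegral_enorm_fourierLocalTime_gaussDerivWeightDeriv_lt_top
    (hD : Measurable (Function.uncurry D)) {α c : ℝ} (hα : 3 / 2 < α) (hα2 : α ≤ 2) (hc : 0 < c)
    (hker : HasKernelBound P D α c) :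
    ∫⁻ r in Set.Ioc (0 : ℝ) 1, ∫⁻ ω, ‖fourierLocalTime D (gaussDerivWeightDeriv r) ω‖ₑ ∂P < ∞ := by
  -- With a = 1 + 2δ this choice gives 2a + 1 = α + 3/2 < 2α, so κ = 2 is admissible.
  set δ := (2 * α - 3) / 8 with hδ
  have hδ0 : 0 < δ := by rw [hδ]; linarith
  have hδ1 : δ ≤ 1 := by rw [hδ]; linarith
  obtain ⟨C, hC, h⟩ := eLpNorm_fourierLocalTime_le (a := 1 + 2 * δ) (κ := 2) (by linarith) hc
    (by linarith) (by norm_num) le_rfl (by rw [hδ]; linarith) hD hker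
  have hle : ∀ r ∈ Set.Ioc (0 : ℝ) 1,
      ∫⁻ ω, ‖fourierLocalTime D (gaussDerivWeightDeriv r) ω‖ₑ ∂P ≤
        ENNReal.ofReal (C * r ^ (δ - 1) * ((2 * 1 : ℕ) : ℝ) ^ (2 : ℝ)) := by
    intro r hr
    refine le_trans ?_ (h (r ^ (δ - 1)) (Real.rpow_nonneg hr.1.le _) _
      (measurable_gaussDerivWeightDeriv r) (integrable_gaussDerivWeightDeriv hr.1)
      (conj_gaussDerivWeightDeriv r) (norm_gaussDerivWeightDeriv_le hr.1 hδ0.le hδ1) 1 le_rfl)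
    rw [← eLpNorm_one_eq_lintegral_enorm]
    exact eLpNorm_le_eLpNorm_of_exponent_le (by norm_num)
      (measurable_fourierLocalTime hD (measurable_gaussDerivWeightDeriv r)).aestronglyMeasurable
  refine (setLIntegral_mono' measurableSet_Ioc hle).trans_lt ?_
  have hint : IntegrableOn (fun r : ℝ => C * r ^ (δ - 1) * ((2 * 1 : ℕ) : ℝ) ^ (2 : ℝ))
      (Set.Ioc 0 1) := by
    have := (intervalIntegral.intervalIntegrable_rpow' (a := 0) (b := 1) (r := δ - 1)
      (by linarith)).1
    exact (this.const_mul C).mul_const _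
  exact hint.lintegral_lt_top

theorem ae_integrableOn_fourierLocalTime_gaussDerivWeightDeriv
    (hD : Measurable (Function.uncurry D)) {α c : ℝ} (hα : 3 / 2 < α) (hα2 : α ≤ 2) (hc : 0 < c)
    (hker : HasKernelBound P D α c) :
    ∀ᵐ ω ∂P, IntegrableOn (fun r => fourierLocalTime D (gaussDerivWeightDeriv r) ω)
      (Set.Icc 0 1) := by
  have hm := measurable_fourierLocalTime_gaussDerivWeightDeriv hD
  have h := lintegral_enorm_fourierLocalTime_gaussDerivWeightDeriv_lt_top hD hα hα2 hc hker
  rw [lintegral_lintegral_swap hm.enorm.aemeasurable] at h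
  filter_upwards [ae_lt_top hm.enorm.lintegral_prod_left' h.ne] with ω hω
  rw [integrableOn_Icc_iff_integrableOn_Ioc]
  exact ⟨(hm.comp measurable_prodMk_right).aestronglyMeasurable, hω⟩

/-- Almost sure convergence of the regularisations. -/
theorem exists_tendsto_fourierLocalTime_gaussDerivWeight
    (hD : Measurable (Function.uncurry D)) {α c : ℝ} (hα : 3 / 2 < α) (hα2 : α ≤ 2) (hc : 0 < c)
    (hker : HasKernelBound P D α c) :
    ∃ θ : Ω → ℝ, Measurable θ ∧ ∀ᵐ ω ∂P,
      Tendsto (fun ε => fourierLocalTime D (gaussDerivWeight ε) ω) (𝓝[>] 0) (𝓝 (θ ω : ℂ)) := by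
  have hm := measurable_fourierLocalTime_gaussDerivWeightDeriv hD
  -- The witness is the value at variance 1 minus the integral of the variance derivative down to 0.
  -- The real part makes it real-valued; the limit is unchanged since the approximations are real.
  refine ⟨fun ω => (fourierLocalTime D (gaussDerivWeight 1) ω -
    ∫ r in (0 : ℝ)..1, fourierLocalTime D (gaussDerivWeightDeriv r) ω).re, ?_, ?_⟩
  · refine Complex.measurable_re.comp
      ((measurable_fourierLocalTime hD (measurable_gaussDerivWeight 1)).sub ?_)
    simp_rw [intervalIntegral.integral_of_le zero_le_one]
    exact (StronglyMeasurable.integral_prod_left'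
      hm.stronglyMeasurable (μ := volume.restrict (Set.Ioc (0 : ℝ) 1))).measurable
  · filter_upwards [ae_integrableOn_fourierLocalTime_gaussDerivWeightDeriv hD hα hα2 hc hker]
      with ω hω
    rw [← Set.uIcc_of_le zero_le_one] at hω
    have hcont := intervalIntegral.continuousOn_primitive_interval_left hω 0 Set.left_mem_uIcc
    rw [Set.uIcc_of_le zero_le_one] at hcont
    have hlim : Tendsto (fun ε => ∫ r in ε..1, fourierLocalTime D (gaussDerivWeightDeriv r) ω)
        (𝓝[>] 0) (𝓝 (∫ r in (0 : ℝ)..1, fourierLocalTime D (gaussDerivWeightDeriv r) ω)) := by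
      refine hcont.tendsto.mono_left ?_
      rw [← nhdsWithin_Ioc_eq_nhdsGT zero_lt_one]
      exact nhdsWithin_mono _ Set.Ioc_subset_Icc_self
    have hlim2 := (tendsto_const_nhds (x := fourierLocalTime D (gaussDerivWeight 1) ω)).sub hlim
    have heq : (fun ε => fourierLocalTime D (gaussDerivWeight 1) ω -
        ∫ r in ε..1, fourierLocalTime D (gaussDerivWeightDeriv r) ω) =ᶠ[𝓝[>] 0]
        fun ε => fourierLocalTime D (gaussDerivWeight ε) ω := by
      filter_upwards [Ioc_mem_nhdsGT zero_lt_one] with ε hε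
      rw [← fourierLocalTime_sub_eq_intervalIntegral hD hε.1 hε.2]
      ring
    have hlim3 := hlim2.congr' heq
    have hre := ((Complex.continuous_ofReal.comp Complex.continuous_re).tendsto _).comp hlim3
    refine hre.congr fun ε => ?_
    exact (fourierLocalTime_eq_ofReal D (conj_gaussDerivWeight ε) ω).symm

/-- Convergence in `L^q` of the regularisations, along any almost sure limit. -/
theorem tendsto_eLpNorm_fourierLocalTime_sub
    (hD : Measurable (Function.uncurry D)) {α c : ℝ} (hα : 3 / 2 < α) (hα2 : α ≤ 2) (hc : 0 < c)
    (hker : HasKernelBound P D α c) {θ : Ω → ℝ} (hθm : Measurable θ)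
    (hθ : ∀ᵐ ω ∂P,
      Tendsto (fun ε => fourierLocalTime D (gaussDerivWeight ε) ω) (𝓝[>] 0) (𝓝 (θ ω : ℂ)))
    {q : ℝ≥0∞} (hq : q < ∞) :
    Tendsto (fun ε : ℝ => eLpNorm (fun ω => fourierLocalTime D (gaussDerivWeight ε) ω -
      (θ ω : ℂ)) q P) (𝓝[>] 0) (𝓝 0) := by
  set δ := (2 * α - 3) / 8 with hδ
  have hδ0 : 0 < δ := by rw [hδ]; linarith
  have hδ1 : δ ≤ 1 := by rw [hδ]; linarith
  obtain ⟨C, hC, h⟩ := eLpNorm_fourierLocalTime_le (a := 1 + 2 * δ) (κ := 2) (by linarith) hc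
    (by linarith) (by norm_num) le_rfl (by rw [hδ]; linarith) hD hker
  obtain ⟨m, hm⟩ := ENNReal.exists_nat_gt hq.ne
  have hqm : q ≤ (2 * (m + 1) : ℕ) := hm.le.trans (by exact_mod_cast (by omega))
  have hΘm : ∀ ε, Measurable (fourierLocalTime D (gaussDerivWeight ε)) := fun ε =>
    measurable_fourierLocalTime hD (measurable_gaussDerivWeight ε)
  set B := ((2 * (m + 1) : ℕ) : ℝ) ^ (2 : ℝ) with hB
  -- For 0 < η ≤ ε the weights differ by at most ε^δ(1+|p|)^(1+2δ). This is uniform in η, so Fatou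
  -- as η ↓ 0 transfers the bound to the limit.
  have hbound : ∀ ε : ℝ, 0 < ε → eLpNorm (fun ω => fourierLocalTime D (gaussDerivWeight ε) ω -
      (θ ω : ℂ)) q P ≤ ENNReal.ofReal (C * ε ^ δ * B) := by
    intro ε hε
    refine (eLpNorm_le_eLpNorm_of_exponent_le hqm ?_).trans ?_
    · exact ((hΘm ε).sub (Complex.measurable_ofReal.comp hθm)).aestronglyMeasurable
    refine eLpNorm_lim_le_of_eventually_le
      (f := fun η ω => fourierLocalTime D (gaussDerivWeight ε) ω -
        fourierLocalTime D (gaussDerivWeight η) ω)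
      (fun η => ((hΘm ε).sub (hΘm η)).aestronglyMeasurable) ?_ ?_
    · filter_upwards [hθ] with ω hω using tendsto_const_nhds.sub hω
    · filter_upwards [Ioc_mem_nhdsGT hε] with η hη
      have hsub : (fun ω => fourierLocalTime D (gaussDerivWeight ε) ω -
          fourierLocalTime D (gaussDerivWeight η) ω) =
          fourierLocalTime D fun p => gaussDerivWeight ε p - gaussDerivWeight η p :=
        funext fun ω => (fourierLocalTime_sub hD (measurable_gaussDerivWeight _)
          (integrable_gaussDerivWeight hε) (measurable_gaussDerivWeight _)
          (integrable_gaussDerivWeight hη.1) ω).symm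
      rw [hsub]
      refine h (ε ^ δ) (by positivity) _
        ((measurable_gaussDerivWeight _).sub (measurable_gaussDerivWeight _))
        ((integrable_gaussDerivWeight hε).sub (integrable_gaussDerivWeight hη.1)) (fun p => ?_)
        (fun p => (norm_gaussDerivWeight_sub_le hε.le hη.1.le hδ0.le hδ1 p).trans ?_) (m + 1)
        (by omega)
      · rw [Pi.sub_apply, Pi.sub_apply, map_sub, conj_gaussDerivWeight, conj_gaussDerivWeight]
      · gcongr
        rw [abs_of_nonneg (by linarith [hη.2])]
        linarith [hη.1]
  have hlim : Tendsto (fun ε : ℝ => ENNReal.ofReal (C * ε ^ δ * B)) (𝓝[>] 0) (𝓝 0) := by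
    have h0 : Tendsto (fun ε : ℝ => C * ε ^ δ * B) (𝓝 0) (𝓝 (C * 0 ^ δ * B)) :=
      ((Real.continuousAt_rpow_const 0 δ (Or.inr hδ0.le)).tendsto.const_mul C).mul_const B
    rw [Real.zero_rpow hδ0.ne', mul_zero, zero_mul] at h0
    have h1 := ENNReal.tendsto_ofReal
      (h0.mono_left (nhdsWithin_le_nhds (s := Set.Ioi (0 : ℝ))))
    rwa [ENNReal.ofReal_zero] at h1
  refine tendsto_of_tendsto_of_tendsto_of_le_of_le' tendsto_const_nhds hlim
    (Eventually.of_forall fun _ => zero_le) ?_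
  filter_upwards [self_mem_nhdsWithin] with ε hε using hbound ε hε

/-- Even moments of the limit. -/
theorem exists_eLpNorm_le_of_tendsto_fourierLocalTime
    (hD : Measurable (Function.uncurry D)) {α c κ : ℝ} (hα : 0 < α) (hc : 0 < c) (hκ0 : 0 ≤ κ)
    (hκ2 : κ ≤ 2) (hκ : 3 < α * κ) (hker : HasKernelBound P D α c) {θ : Ω → ℝ}
    (hθ : ∀ᵐ ω ∂P,
      Tendsto (fun ε => fourierLocalTime D (gaussDerivWeight ε) ω) (𝓝[>] 0) (𝓝 (θ ω : ℂ))) :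
    ∃ C : ℝ, 0 ≤ C ∧ ∀ m : ℕ, 1 ≤ m →
      eLpNorm (fun ω => (θ ω : ℂ)) (2 * m : ℕ) P ≤
        ENNReal.ofReal (C * ((2 * m : ℕ) : ℝ) ^ κ) := by
  obtain ⟨C, hC, h⟩ := eLpNorm_fourierLocalTime_le (a := 1) (κ := κ) hα hc zero_le_one hκ0 hκ2
    (by linarith) hD hker
  refine ⟨C, hC, fun m hm => ?_⟩
  refine eLpNorm_lim_le_of_eventually_le
    (f := fun η ω => fourierLocalTime D (gaussDerivWeight η) ω)
    (fun η => (measurable_fourierLocalTime hD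
      (measurable_gaussDerivWeight η)).aestronglyMeasurable) hθ ?_
  filter_upwards [self_mem_nhdsWithin] with η hη
  have := h 1 zero_le_one _ (measurable_gaussDerivWeight η) (integrable_gaussDerivWeight hη)
    (conj_gaussDerivWeight η) (norm_gaussDerivWeight_le (le_of_lt hη)) m hm
  rwa [mul_one] at this

end

/-! ### From moment growth to exponential moments -/

theorem natCast_pow_self_le_exp_mul_factorial (k : ℕ) :
    (k : ℝ) ^ k ≤ Real.exp 1 ^ k * k.factorial := by
  have := Real.pow_div_factorial_le_exp (k : ℝ) (Nat.cast_nonneg k) k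
  rw [div_le_iff₀ (by positivity)] at this
  rwa [← Real.exp_nat_mul, mul_one]

section

variable {Ω : Type*} [MeasurableSpace Ω] {P : Measure Ω}

/-- A nonnegative random variable whose `k`-th moments are at most `R ^ k k!` has an exponential
moment. -/
theorem exists_integrable_exp_of_moments_le {Y : Ω → ℝ} (hY : AEMeasurable Y P)
    (hY0 : ∀ ω, 0 ≤ Y ω) {R : ℝ} (hR : 0 < R)
    (h : ∀ k : ℕ, ∫⁻ ω, ENNReal.ofReal (Y ω ^ k) ∂P ≤ ENNReal.ofReal (R ^ k * k.factorial)) :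
    ∃ M : ℝ, 0 < M ∧ Integrable (fun ω => Real.exp (M * Y ω)) P := by
  -- With M = 1/(2R) the exponential series is dominated term by term by ∑ 2^(-k).
  refine ⟨(2 * R)⁻¹, by positivity, ?_⟩
  set M := (2 * R)⁻¹ with hM
  have hM0 : 0 < M := by positivity
  refine ⟨(Real.measurable_exp.comp_aemeasurable (hY.const_mul M)).aestronglyMeasurable, ?_⟩
  rw [hasFiniteIntegral_iff_ofReal (ae_of_all _ fun ω => (Real.exp_pos _).le)]
  have hexp : ∀ ω, ENNReal.ofReal (Real.exp (M * Y ω)) =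
      ∑' k : ℕ, ENNReal.ofReal (M ^ k / k.factorial) * ENNReal.ofReal (Y ω ^ k) := by
    intro ω
    have hs := Real.summable_pow_div_factorial (M * Y ω)
    have hnn : ∀ k : ℕ, 0 ≤ (M * Y ω) ^ k / k.factorial := fun k => by
      have := mul_nonneg hM0.le (hY0 ω); positivity
    rw [Real.exp_eq_exp_ℝ, NormedSpace.exp_eq_tsum_div, ENNReal.ofReal_tsum_of_nonneg hnn hs]
    congr with k
    rw [← ENNReal.ofReal_mul (by positivity)]
    congr 1
    ring
  simp_rw [hexp]
  rw [lintegral_tsum fun k => ((hY.pow_const k).ennreal_ofReal.const_mul _)]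
  have hterm : ∀ k : ℕ, ∫⁻ ω, ENNReal.ofReal (M ^ k / k.factorial) * ENNReal.ofReal (Y ω ^ k) ∂P ≤
      ENNReal.ofReal ((1 / 2) ^ k) := by
    intro k
    rw [lintegral_const_mul'' _ (hY.pow_const k).ennreal_ofReal]
    calc _ ≤ ENNReal.ofReal (M ^ k / k.factorial) * ENNReal.ofReal (R ^ k * k.factorial) := by
          gcongr; exact h k
      _ = ENNReal.ofReal ((1 / 2) ^ k) := by
          rw [← ENNReal.ofReal_mul (by positivity)]
          congr 1
          have hMR : M * R = 1 / 2 := by rw [hM]; field_simp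
          rw [← hMR, mul_pow]
          field_simp
  refine (ENNReal.tsum_le_tsum hterm).trans_lt ?_
  rw [← ENNReal.ofReal_tsum_of_nonneg (fun k => by positivity) summable_geometric_two]
  exact ENNReal.ofReal_lt_top

variable [IsProbabilityMeasure P]

/-- Since β ≤ 2, the moment of order βk is controlled by the L^(2k) norm. Then κβ ≤ 1 bounds the
growth by (2k)^k, and k^k ≤ e^k k! gives the factorial form. -/
theorem lintegral_rpow_le_of_eLpNorm_le {θ : Ω → ℝ} (hθm : AEMeasurable θ P) {C κ β : ℝ}
    (hC : 0 ≤ C) (hβ0 : 0 < β) (hβ2 : β ≤ 2) (hκβ : κ * β ≤ 1)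
    (hmom : ∀ m : ℕ, 1 ≤ m →
      eLpNorm (fun ω => (θ ω : ℂ)) (2 * m : ℕ) P ≤ ENNReal.ofReal (C * ((2 * m : ℕ) : ℝ) ^ κ))
    (k : ℕ) :
    ∫⁻ ω, ENNReal.ofReal ((|θ ω| ^ β) ^ k) ∂P ≤
      ENNReal.ofReal ((2 * Real.exp 1 * C ^ β) ^ k * k.factorial) := by
  rcases Nat.eq_zero_or_pos k with rfl | hk
  · simp
  have hk0 : (0 : ℝ) < k := by exact_mod_cast hk
  have hq0 : 0 < β * k := by positivity
  have hb : (0 : ℝ) < (2 * k : ℕ) := by exact_mod_cast (by omega)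
  have h1 : eLpNorm (fun ω => (θ ω : ℂ)) (ENNReal.ofReal (β * k)) P ≤
      ENNReal.ofReal (C * ((2 * k : ℕ) : ℝ) ^ κ) := by
    refine (eLpNorm_le_eLpNorm_of_exponent_le ?_ ?_).trans (hmom k hk)
    · rw [← ENNReal.ofReal_natCast]
      refine ENNReal.ofReal_le_ofReal ?_
      push_cast
      gcongr
    · exact (Complex.measurable_ofReal.comp_aemeasurable hθm).aestronglyMeasurable
  rw [eLpNorm_eq_lintegral_rpow_enorm_toReal (by simpa using hq0) ENNReal.ofReal_ne_top,
    ENNReal.toReal_ofReal hq0.le] at h1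
  have h2 := ENNReal.rpow_le_rpow h1 hq0.le
  rw [← ENNReal.rpow_mul, one_div_mul_cancel hq0.ne', ENNReal.rpow_one,
    ENNReal.ofReal_rpow_of_nonneg (by positivity) hq0.le] at h2
  calc ∫⁻ ω, ENNReal.ofReal ((|θ ω| ^ β) ^ k) ∂P
      = ∫⁻ ω, ‖(θ ω : ℂ)‖ₑ ^ (β * k) ∂P := by
        refine lintegral_congr fun ω => ?_
        rw [← ofReal_norm, Complex.norm_real, Real.norm_eq_abs,
          ENNReal.ofReal_rpow_of_nonneg (abs_nonneg _) hq0.le, Real.rpow_mul_natCast (abs_nonneg _)]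
    _ ≤ _ := h2
    _ ≤ _ := by
        refine ENNReal.ofReal_le_ofReal ?_
        rw [Real.mul_rpow hC (by positivity), Real.rpow_mul_natCast hC, ← Real.rpow_mul hb.le]
        have h3 : ((2 * k : ℕ) : ℝ) ^ (κ * (β * k)) ≤ (2 * k) ^ k := by
          have h1b : (1 : ℝ) ≤ (2 * k : ℕ) := by exact_mod_cast (by omega)
          calc ((2 * k : ℕ) : ℝ) ^ (κ * (β * k)) ≤ ((2 * k : ℕ) : ℝ) ^ (k : ℝ) := by
                refine Real.rpow_le_rpow_of_exponent_le h1b ?_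
                nlinarith
            _ = (2 * k) ^ k := by rw [Real.rpow_natCast]; push_cast; rfl
        calc (C ^ β) ^ k * ((2 * k : ℕ) : ℝ) ^ (κ * (β * k))
            ≤ (C ^ β) ^ k * (2 ^ k * (Real.exp 1 ^ k * k.factorial)) := by
              gcongr
              refine h3.trans ?_
              rw [mul_pow]
              gcongr
              exact natCast_pow_self_le_exp_mul_factorial k
          _ = _ := by rw [mul_pow, mul_pow]; ring

end

/-! ### Joint measurability and reduction to a random field -/

theorem measurable_comp_countable {Ω E T : Type*} [MeasurableSpace Ω] [MeasurableSpace E]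
    {Y : T → Ω → ℝ} (hm : ∀ t, Measurable (Y t)) (e : ℕ → T) {f : E → ℕ} (hf : Measurable f) :
    Measurable fun a : E × Ω => Y (e (f a.1)) a.2 := by
  have h1 : Measurable fun b : ℕ × Ω => Y (e b.1) b.2 :=
    measurable_from_prod_countable_right fun k => hm (e k)
  exact h1.comp ((hf.comp measurable_fst).prodMk measurable_snd)

/-- A process with right-continuous paths is jointly measurable. -/
theorem measurable_uncurry_of_rightContinuous {Ω : Type*} [MeasurableSpace Ω] {Y : ℝ≥0 → Ω → ℝ}
    (hm : ∀ t, Measurable (Y t))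
    (hr : ∀ ω t, ContinuousWithinAt (fun s => Y s ω) (Set.Ici t) t) :
    Measurable (Function.uncurry Y) := by
  -- The next point of the grid of mesh 1/(n+1) strictly to the right of t: only countably many
  -- values occur, and the +1 makes the approach from the right.
  let d : ℕ → ℝ≥0 → ℝ≥0 := fun n t => (⌊(n + 1) * t⌋₊ + 1) / (n + 1)
  have hd_ge : ∀ n t, t ≤ d n t := by
    intro n t
    rw [le_div_iff₀ (by positivity), mul_comm]
    exact (Nat.lt_floor_add_one _).le
  have hd_le : ∀ n t, d n t ≤ t + 1 / (n + 1) := by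
    intro n t
    have hn : (n : ℝ≥0) + 1 ≠ 0 := by positivity
    rw [div_le_iff₀ (by positivity), add_mul t, one_div_mul_cancel hn, mul_comm t]
    gcongr
    exact Nat.floor_le zero_le
  have hd_lim : ∀ t, Tendsto (fun n => d n t) atTop (𝓝[≥] t) := by
    intro t
    refine tendsto_nhdsWithin_iff.2 ⟨?_, Eventually.of_forall fun n => hd_ge n t⟩
    refine tendsto_of_tendsto_of_tendsto_of_le_of_le tendsto_const_nhds ?_ (fun n => hd_ge n t)
      (fun n => hd_le n t)
    have h : Tendsto (fun n : ℕ => t + 1 / ((n : ℝ≥0) + 1)) atTop (𝓝 (t + 0)) :=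
      tendsto_const_nhds.add tendsto_one_div_add_atTop_nhds_zero_nat
    rwa [add_zero] at h
  have hdm : ∀ n, Measurable fun a : ℝ≥0 × Ω => Y (d n a.1) a.2 := fun n =>
    measurable_comp_countable hm (fun k : ℕ => ((k : ℝ≥0) + 1) / (n + 1))
      (f := fun t : ℝ≥0 => ⌊((n : ℝ≥0) + 1) * t⌋₊)
      (Nat.measurable_floor.comp (measurable_id.const_mul _))
  exact measurable_of_tendsto_metrizable hdm
    (tendsto_pi_nhds.2 fun a => (hr a.2 a.1).tendsto.comp (hd_lim a.1))

section

variable {Ω : Type*} [MeasurableSpace Ω] {P : Measure Ω}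

/-- A Lévy process is indistinguishable from a jointly measurable process. -/
theorem IsLevyProcess.exists_measurable_modification {X : ℝ≥0 → Ω → ℝ}
    (hX : IsLevyProcess P X) :
    ∃ Y : ℝ≥0 → Ω → ℝ, Measurable (Function.uncurry Y) ∧ ∀ᵐ ω ∂P, ∀ t, Y t ω = X t ω := by
  classical
  obtain ⟨N, hN, hNm, hN0⟩ := exists_measurable_superset_of_null (ae_iff.1 hX.cadlag)
  -- Paths are replaced by 0 on a measurable null set, so that right-continuity holds for every ω.
  refine ⟨fun t => N.indicator 0 + Nᶜ.indicator (X t), ?_, ?_⟩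
  · refine measurable_uncurry_of_rightContinuous (fun t => ?_) fun ω t => ?_
    · exact (measurable_zero.indicator hNm).add ((hX.measurable t).indicator hNm.compl)
    · by_cases hω : ω ∈ N
      · simp [hω, continuousWithinAt_const]
      · have hc : ∀ t, ContinuousWithinAt (fun s => X s ω) (Set.Ici t) t := fun t => by
          by_contra hcon
          exact hω (hN fun h => hcon (h t).1)
        simpa [hω] using hc t
  · have : ∀ᵐ ω ∂P, ω ∉ N := measure_eq_zero_iff_ae_notMem.1 hN0
    filter_upwards [this] with ω hω t
    simp [hω]

theorem diltApprox_eq_fourierLocalTime {X Y : ℝ≥0 → Ω → ℝ} {D : ℝ × ℝ → Ω → ℝ}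
    (hD : Measurable (Function.uncurry D)) {ω : Ω}
    (h : ∀ z : ℝ × ℝ, D z ω = X z.1.toNNReal ω - Y z.2.toNNReal ω) {ε : ℝ} (hε : 0 < ε) :
    diltApprox X Y ε ω = fourierLocalTime D (gaussDerivWeight ε) ω := by
  have hint := integrable_fourierIntegrand hD (measurable_gaussDerivWeight ε)
    (integrable_gaussDerivWeight hε) ω
  have hint2 : ∀ᵐ t ∂(volume.restrict (Set.Ioc (0 : ℝ) 1)),
      Integrable (fun y => fourierIntegrand D (gaussDerivWeight ε) ω (t, y))
        ((volume.restrict (Set.Ioc (0 : ℝ) 1)).prod volume) := by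
    unfold timeFreqMeasure at hint
    exact hint.prod_right_ae
  have hpt : ∀ t s p : ℝ, Complex.I / (2 * (Real.pi : ℂ)) *
      ((p : ℂ) * Complex.exp (Complex.I * (p : ℂ) *
        ((X t.toNNReal ω - Y s.toNNReal ω : ℝ) : ℂ)) * Complex.exp (-((ε * p ^ 2 / 2 : ℝ) : ℂ))) =
      fourierIntegrand D (gaussDerivWeight ε) ω (t, s, p) := by
    intro t s p
    simp only [fourierIntegrand, gaussDerivWeight, h]
    push_cast
    ring_nf
  unfold diltApprox fourierLocalTime
  simp_rw [intervalIntegral.integral_of_le zero_le_one, ← integral_const_mul, hpt]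
  unfold timeFreqMeasure at hint ⊢
  rw [integral_prod _ hint]
  refine integral_congr_ae ?_
  filter_upwards [hint2] with t ht
  rw [integral_prod _ ht]

theorem HasStableDecay.mono {X : ℝ≥0 → Ω → ℝ} {α c c' : ℝ} (h : HasStableDecay P X α c)
    (hc : c' ≤ c) : HasStableDecay P X α c' := by
  intro s t u hst
  refine (h s t u hst).trans (Real.exp_le_exp.2 ?_)
  have h1 : (0 : ℝ) ≤ t - s := sub_nonneg.2 (by exact_mod_cast hst)
  have h2 : 0 ≤ |u| ^ α := by positivity
  gcongr

variable [IsProbabilityMeasure P]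

/-- The difference of two independent symmetric stable processes, up to indistinguishability. -/
theorem exists_hasKernelBound {α : ℝ} (hα : 0 < α) {X Y : ℝ≥0 → Ω → ℝ}
    (hX : IsSymmetricStableProcess α P X) (hY : IsSymmetricStableProcess α P Y)
    (hindep : IndepFun (fun ω t => X t ω) (fun ω t => Y t ω) P) :
    ∃ (D : ℝ × ℝ → Ω → ℝ) (c : ℝ), 0 < c ∧ Measurable (Function.uncurry D) ∧
      HasKernelBound P D α c ∧
      ∀ᵐ ω ∂P, ∀ z : ℝ × ℝ, D z ω = X z.1.toNNReal ω - Y z.2.toNNReal ω := by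
  obtain ⟨c₁, hc₁, hd₁⟩ := hX.exists_hasStableDecay hα
  obtain ⟨c₂, hc₂, hd₂⟩ := hY.exists_hasStableDecay hα
  obtain ⟨X', hX'm, hX'⟩ := hX.levy.exists_measurable_modification
  obtain ⟨Y', hY'm, hY'⟩ := hY.levy.exists_measurable_modification
  have hD : ∀ᵐ ω ∂P, ∀ z : ℝ × ℝ, X' z.1.toNNReal ω - Y' z.2.toNNReal ω =
      X z.1.toNNReal ω - Y z.2.toNNReal ω := by
    filter_upwards [hX', hY'] with ω h1 h2 z
    rw [h1, h2]
  refine ⟨fun z ω => X' z.1.toNNReal ω - Y' z.2.toNNReal ω, min c₁ c₂, lt_min hc₁ hc₂, ?_, ?_, hD⟩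
  · have h1 : Measurable fun a : (ℝ × ℝ) × Ω => X' a.1.1.toNNReal a.2 :=
      hX'm.comp (by fun_prop : Measurable fun a : (ℝ × ℝ) × Ω => (a.1.1.toNNReal, a.2))
    have h2 : Measurable fun a : (ℝ × ℝ) × Ω => Y' a.1.2.toNNReal a.2 :=
      hY'm.comp (by fun_prop : Measurable fun a : (ℝ × ℝ) × Ω => (a.1.2.toNNReal, a.2))
    exact h1.sub h2
  · intro lam hlam n t s q ht hs
    refine le_trans (le_of_eq (congrArg _ (integral_congr_ae ?_)))
      (enorm_integral_exp_sub_le_symKernel_mul hX.levy hY.levy hindep (hd₁.mono (min_le_left _ _))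
        (hd₂.mono (min_le_right _ _)) hlam (fun j => (ht j).1.le) (fun j => (ht j).2)
        (fun j => (hs j).1.le) (fun j => (hs j).2) q)
    filter_upwards [hD] with ω hω
    exact congrArg (fun x : ℝ => Complex.exp (Complex.I * x))
      (Finset.sum_congr rfl fun j _ => congrArg (q j * ·) (hω (t j, s j)))

end

theorem theorem2p1 {Ω : Type*} [MeasurableSpace Ω] (P : Measure Ω) [IsProbabilityMeasure P]
    (α : ℝ) (hα : 3 / 2 < α) (hα' : α ≤ 2)
    (X₁ X₂ : ℝ≥0 → Ω → ℝ)
    (hX₁ : IsSymmetricStableProcess α P X₁) (hX₂ : IsSymmetricStableProcess α P X₂)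
    (hindep : IndepFun (fun ω t => X₁ t ω) (fun ω t => X₂ t ω) P) :
    (∃ θ : Ω → ℝ, IsDILT P X₁ X₂ θ) ∧
      ∀ θ : Ω → ℝ, IsDILT P X₁ X₂ θ → ∀ β : ℝ, 0 ≤ β → β < α / 3 →
        ∃ M : ℝ, 0 < M ∧ Integrable (fun ω => Real.exp (M * |θ ω| ^ β)) P := by
  have hα0 : 0 < α := by linarith
  obtain ⟨D, c, hc, hDm, hker, hD⟩ := exists_hasKernelBound hα0 hX₁ hX₂ hindep
  have hΘ : ∀ᵐ ω ∂P, ∀ ε : ℝ, 0 < ε →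
      fourierLocalTime D (gaussDerivWeight ε) ω = diltApprox X₁ X₂ ε ω := by
    filter_upwards [hD] with ω hω ε hε
    exact (diltApprox_eq_fourierLocalTime hDm hω hε).symm
  refine ⟨?_, fun θ hθ β hβ0 hβ => ?_⟩
  · obtain ⟨θ, hθm, hθ⟩ :=
      exists_tendsto_fourierLocalTime_gaussDerivWeight hDm hα hα' hc hker
    refine ⟨θ, hθm.aemeasurable, ?_, fun q _ hq => ?_⟩
    · filter_upwards [hΘ, hθ] with ω h1 h2
      refine h2.congr' ?_
      filter_upwards [self_mem_nhdsWithin] with ε hε using h1 ε hε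
    · refine (tendsto_eLpNorm_fourierLocalTime_sub hDm hα hα' hc hker hθm hθ hq).congr' ?_
      filter_upwards [self_mem_nhdsWithin] with ε hε
      refine eLpNorm_congr_ae ?_
      filter_upwards [hΘ] with ω h1
      rw [h1 ε hε]
  · rcases hβ0.eq_or_lt with rfl | hβ0
    · exact ⟨1, one_pos, by simp⟩
    have hθlim : ∀ᵐ ω ∂P, Tendsto (fun ε => fourierLocalTime D (gaussDerivWeight ε) ω) (𝓝[>] 0)
        (𝓝 (θ ω : ℂ)) := by
      filter_upwards [hΘ, hθ.tendsto_ae] with ω h1 h2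
      refine h2.congr' ?_
      filter_upwards [self_mem_nhdsWithin] with ε hε using (h1 ε hε).symm
    -- The exponent κ = min(2, 1/β) meets κ ≤ 2 and κβ ≤ 1; the condition 3 < ακ amounts to α > 3/2
    -- together with β < α/3.
    have hκ : 3 < α * min 2 (1 / β) := by
      rcases min_choice 2 (1 / β) with h | h <;> rw [h]
      · linarith
      · rw [mul_one_div, lt_div_iff₀ hβ0]; linarith
    have hκβ : min 2 (1 / β) * β ≤ 1 :=
      (mul_le_mul_of_nonneg_right (min_le_right _ _) hβ0.le).trans_eq (one_div_mul_cancel hβ0.ne')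
    obtain ⟨C, hC, hmom⟩ := exists_eLpNorm_le_of_tendsto_fourierLocalTime hDm hα0 hc
      (by positivity) (min_le_left _ _) hκ hker hθlim
    have hCβ : 0 ≤ C ^ β := by positivity
    -- The added 1 keeps R positive when C = 0.
    refine exists_integrable_exp_of_moments_le (R := 2 * Real.exp 1 * C ^ β + 1)
      ((continuous_abs.rpow_const fun _ => Or.inr hβ0.le).measurable.comp_aemeasurable
        hθ.aemeasurable) (fun ω => by positivity) (by positivity) fun k => ?_
    refine (lintegral_rpow_le_of_eLpNorm_le hθ.aemeasurable hC hβ0 (by linarith) hκβ hmom k).trans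
      (ENNReal.ofReal_le_ofReal ?_)
    gcongr
    linarith
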